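/- Fix $T\ge 2$, weights $\xi\in\mathbb{R}^T$ with $\xi_t\ge 0$, $\sum_t\xi_t=1$, and a probability mass function $\mathbf{\Pi}$ on $\{0,1\}^T$ with support $\mathbb{S}^*$. Let $J=I_T-\mathbf 1_T\mathbf 1_T^\top/T$ and assume that $(\mathbf{\Pi},\xi)$ solves the DATE equation $$\mathbb{E}_{\mathbf W\sim\mathbf{\Pi}}\big[(\mathrm{diag}(\mathbf W)-\xi\mathbf W^\top)J(\mathbf W-\mathbb{E}_{\mathbf W\sim\mathbf{\Pi}}[\mathbf W])\big]=0 .$$ For every $n$ consider a finite population of $n$ units with fixed potential outcomes $Y_{it}(1),Y_{it}(0)$ and random assignment paths $\mathbf W_i=(W_{i1},\dots,W_{iT})\in\{0,1\}^T$ (everything may depend on $n$, as a triangular array); put $\boldsymbol\pi_i(\mathbf w)=\mathbb{P}[\mathbf W_i=\mathbf w]$, $Y_{it}=Y_{it}(1)W_{it}+Y_{it}(0)(1-W_{it})$, $\mathbf Y_i=(Y_{i1},\dots,Y_{iT})^\top$, and $$\tau^*(\xi)=\sum_{t=1}^T\xi_t\,\frac1n\sum_{i=1}^n\big(Y_{it}(1)-Y_{it}(0)\big),\qquad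 \Theta_i=\mathbf{\Pi}(\mathbf W_i)/\boldsymbol\pi_i(\mathbf W_i).$$ Let $\hat\tau$ be the $\tau$-component of a solution of $$\min_{\tau,\mu,\ \sum_i\alpha_i=\sum_t\lambda_t=0}\ \sum_{i=1}^n\sum_{t=1}^T\big(Y_{it}-\mu-\alpha_i-\lambda_t-W_{it}\tau\big)^2\,\Theta_i$$ (any choice, if it is not unique). Let $$\Gamma_\theta=\tfrac1n\sum_i\Theta_i,\quad \Gamma_{ww}=\tfrac1n\sum_i\Theta_i\mathbf W_i^\top J\mathbf W_i,\quad \Gamma_{wy}=\tfrac1n\sum_i\Theta_i\mathbf W_i^\top J\mathbf Y_i,\quad \mathbf\Gamma_w=\tfrac1n\sum_i\Theta_iJ\mathbf W_i,\quad \mathbf\Gamma_y=\tfrac1n\sum_i\Theta_iJ\mathbf Y_i,$$ $\mathcal D=\Gamma_{ww}\Gamma_\theta-\mathbf\Gamma_w^\top\mathbf\Gamma_w$, $$\begin{aligned}\mathcal V_i=\Theta_i\Big\{&\big(\mathbb{E}[\Gamma_{wy}]-\tau^*(\xi)\mathbb{E}[\Gamma_{ww}]\big)-\big(\mathbb{E}[\mathbf\Gamma_y]-\tau^*(\xi)\mathbb{E}[\mathbf\Gamma_w]\big)^\top\mathbf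 W_i\\&+\mathbb{E}[\Gamma_\theta]\,\mathbf W_i^\top J(\mathbf Y_i-\tau^*(\xi)\mathbf W_i)-\mathbb{E}[\mathbf\Gamma_w]^\top(\mathbf Y_i-\tau^*(\xi)\mathbf W_i)\Big\},\end{aligned}$$ and let $\hat{\mathcal V}_i$ be the same expression with $\hat\tau$ in place of $\tau^*(\xi)$ and with $\Gamma$ in place of every $\mathbb{E}[\Gamma]$. Let $\hat\sigma^2=\frac1{n-1}\sum_i\big(\hat{\mathcal V}_i-\frac1n\sum_j\hat{\mathcal V}_j\big)^2$ and let $z_\eta$ be the $\eta$-quantile of $N(0,1)$. Assume, with constants $c,\nu_0>0$ and $M<\infty$ and a set $\mathbb{S}^*$ that do not depend on $n$: (i) for every $n$, $\mathbf W_1,\dots,\mathbf W_n$ are independent; (ii) $\mathbb{S}^*$ has at least two elements and at least one element not in $\{\mathbf 0_T,\mathbf 1_T\}$, and $\boldsymbol\pi_i(\mathbf w)>c$ for all $\mathbf w\in\mathbb{S}^*$ and $i\in[n]$; (iii) $|Y_{it}(w)|<M$ for all $i,t,w$; (iv) $\frac1n\sum_{i=1}^n\mathrm{Var}(\mathcal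 V_i)\ge\nu_0$ for all sufficiently large $n$. Then for every $\alpha\in(0,1)$ the interval $\hat C_{1-\alpha}=\big[\hat\tau-z_{1-\alpha/2}\,\hat\sigma/(\sqrt n\,\mathcal D),\ \hat\tau+z_{1-\alpha/2}\,\hat\sigma/(\sqrt n\,\mathcal D)\big]$ satisfies $$\liminf_{n\to\infty}\mathbb{P}\big(\tau^*(\xi)\in\hat C_{1-\alpha}\big)\ge 1-\alpha .$$ -/

import Mathlib

open MeasureTheory ProbabilityTheory Filter
open scoped Matrix

noncomputable section

namespace RIPW

/-- Assignment paths `w ∈ {0,1}^T`, with `true` standing for `1` (treated). -/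
abbrev Path (T : ℕ) : Type := Fin T → Bool

/-- A path as a vector of zeros and ones in `ℝ^T`. -/
def vec {T : ℕ} (w : Path T) : Fin T → ℝ := fun t => if w t then 1 else 0

/-- The centering matrix `J = I_T - 1_T 1_Tᵀ / T`. -/
def J (T : ℕ) : Matrix (Fin T) (Fin T) ℝ :=
  1 - (T : ℝ)⁻¹ • Matrix.of (fun _ _ => (1 : ℝ))

/-- `p` is a probability mass function on `{0,1}^T` whose support is exactly `S`. -/
structure IsReshapedDistribution {T : ℕ} (p : Path T → ℝ) (S : Set (Path T)) : Prop where
  nonneg : ∀ w, 0 ≤ p w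
  sum_eq_one : ∑ w, p w = 1
  support_eq : Function.support p = S

/-- The mean vector `E_{W ∼ p}[W]`. -/
def meanPath {T : ℕ} (p : Path T → ℝ) : Fin T → ℝ := ∑ w, p w • vec w

/-- The DATE equation `E_{W ∼ p}[(diag(W) - ξ Wᵀ) J (W - E_{W ∼ p}[W])] = 0`. -/
def DATEEquation {T : ℕ} (p : Path T → ℝ) (ξ : Fin T → ℝ) : Prop :=
  ∑ w, p w • ((Matrix.diagonal (vec w) - Matrix.vecMulVec ξ (vec w)) *ᵥ
    (J T *ᵥ (vec w - meanPath p))) = 0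

/-- The doubly averaged treatment effect `τ*(ξ) = ∑_t ξ_t (1/n) ∑_i (Y_it(1) - Y_it(0))`;
`Y i t true` is `Y_it(1)` and `Y i t false` is `Y_it(0)`. -/
def date {n T : ℕ} (ξ : Fin T → ℝ) (Y : Fin n → Fin T → Bool → ℝ) : ℝ :=
  ∑ t, ξ t * ((n : ℝ)⁻¹ * ∑ i, (Y i t true - Y i t false))

/-- The observed outcomes of one unit with potential outcomes `y` on the path `w`. -/
def obs {T : ℕ} (y : Fin T → Bool → ℝ) (w : Path T) : Fin T → ℝ :=
  fun t => y t true * vec w t + y t false * (1 - vec w t)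

/-- The generalized propensity score `π(w) = P[W = w]`. -/
def propensity {Ω : Type*} [MeasurableSpace Ω] {T : ℕ} (P : Measure Ω) (W : Ω → Path T)
    (w : Path T) : ℝ :=
  P.real {ω | W ω = w}

/-- Overlap for `n` units with constant `c`: `S` has at least two elements, one of which is neither
`0_T` nor `1_T`, and every path in `S` has probability larger than `c` for every unit. -/
structure Overlap {Ω : Type*} [MeasurableSpace Ω] {n T : ℕ} (c : ℝ) (S : Set (Path T))
    (P : Measure Ω) (W : Fin n → Ω → Path T) : Prop where
  nontrivial : S.Nontrivial
  exists_nonconstant : ∃ w ∈ S, w ≠ (fun _ => false) ∧ w ≠ (fun _ => true)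
  lt_propensity : ∀ i, ∀ w ∈ S, c < propensity P (W i) w

section Estimator

variable {Ω : Type*} [MeasurableSpace Ω] {n T : ℕ}

/-- The reshaped inverse propensity weight `Θ_i = p(W_i) / π_i(W_i)`. -/
def Theta (p : Path T → ℝ) (P : Measure Ω) (W : Fin n → Ω → Path T) (i : Fin n) (ω : Ω) : ℝ :=
  p (W i ω) / propensity P (W i) (W i ω)

/-- The weighted two-way fixed effects objective
`∑_i ∑_t (Y_it - μ - α_i - λ_t - W_it τ)² Θ_i` at the realization `ω`. -/
def objective (p : Path T → ℝ) (P : Measure Ω) (W : Fin n → Ω → Path T)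
    (Y : Fin n → Fin T → Bool → ℝ) (ω : Ω) (τ μ : ℝ) (α : Fin n → ℝ) (l : Fin T → ℝ) : ℝ :=
  ∑ i, ∑ t, (obs (Y i) (W i ω) t - μ - α i - l t - vec (W i ω) t * τ) ^ 2 * Theta p P W i ω

/-- `τ` is the treatment coefficient of a minimizer of the weighted two-way fixed effects objective
subject to `∑_i α_i = ∑_t λ_t = 0`. -/
def IsRIPWEstimate (p : Path T → ℝ) (P : Measure Ω) (W : Fin n → Ω → Path T)
    (Y : Fin n → Fin T → Bool → ℝ) (ω : Ω) (τ : ℝ) : Prop :=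
  ∃ (μ : ℝ) (α : Fin n → ℝ) (l : Fin T → ℝ), ∑ i, α i = 0 ∧ ∑ t, l t = 0 ∧
    ∀ (τ' μ' : ℝ) (α' : Fin n → ℝ) (l' : Fin T → ℝ), ∑ i, α' i = 0 → ∑ t, l' t = 0 →
      objective p P W Y ω τ μ α l ≤ objective p P W Y ω τ' μ' α' l'

/-- `Γ_θ = (1/n) ∑_i Θ_i`. -/
def GammaTheta (p : Path T → ℝ) (P : Measure Ω) (W : Fin n → Ω → Path T) (ω : Ω) : ℝ :=
  (n : ℝ)⁻¹ * ∑ i, Theta p P W i ω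

/-- `Γ_ww = (1/n) ∑_i Θ_i W_iᵀ J W_i`. -/
def GammaWW (p : Path T → ℝ) (P : Measure Ω) (W : Fin n → Ω → Path T) (ω : Ω) : ℝ :=
  (n : ℝ)⁻¹ * ∑ i, Theta p P W i ω * (vec (W i ω) ⬝ᵥ (J T *ᵥ vec (W i ω)))

/-- `Γ_wy = (1/n) ∑_i Θ_i W_iᵀ J Y_i^obs`. -/
def GammaWY (p : Path T → ℝ) (P : Measure Ω) (W : Fin n → Ω → Path T)
    (Y : Fin n → Fin T → Bool → ℝ) (ω : Ω) : ℝ :=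
  (n : ℝ)⁻¹ * ∑ i, Theta p P W i ω * (vec (W i ω) ⬝ᵥ (J T *ᵥ obs (Y i) (W i ω)))

/-- `Γ_w = (1/n) ∑_i Θ_i J W_i`, a vector in `ℝ^T`. -/
def GammaW (p : Path T → ℝ) (P : Measure Ω) (W : Fin n → Ω → Path T) (ω : Ω) : Fin T → ℝ :=
  (n : ℝ)⁻¹ • ∑ i, Theta p P W i ω • (J T *ᵥ vec (W i ω))

/-- `Γ_y = (1/n) ∑_i Θ_i J Y_i^obs`, a vector in `ℝ^T`. -/
def GammaY (p : Path T → ℝ) (P : Measure Ω) (W : Fin n → Ω → Path T)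
    (Y : Fin n → Fin T → Bool → ℝ) (ω : Ω) : Fin T → ℝ :=
  (n : ℝ)⁻¹ • ∑ i, Theta p P W i ω • (J T *ᵥ obs (Y i) (W i ω))

/-- `D = Γ_ww Γ_θ - Γ_wᵀ Γ_w`. -/
def DD (p : Path T → ℝ) (P : Measure Ω) (W : Fin n → Ω → Path T) (ω : Ω) : ℝ :=
  GammaWW p P W ω * GammaTheta p P W ω - GammaW p P W ω ⬝ᵥ GammaW p P W ω

/-- The common form of `V_i` and of its plug-in version, as a function of the weight `θ`, the path
`x`, the observed outcomes `y`, an effect `τ` and values `gθ, gww, gwy, gw, gy` for the `Γ`s. -/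
def influence (τ gθ gww gwy : ℝ) (gw gy : Fin T → ℝ) (θ : ℝ) (x y : Fin T → ℝ) : ℝ :=
  θ * ((gwy - τ * gww) - (gy - τ • gw) ⬝ᵥ x + gθ * (x ⬝ᵥ (J T *ᵥ (y - τ • x)))
    - gw ⬝ᵥ (y - τ • x))

/-- `V_i`: the influence term at `τ*(ξ)` and at the expectations of the `Γ`s. -/
def V (p : Path T → ℝ) (ξ : Fin T → ℝ) (P : Measure Ω) (W : Fin n → Ω → Path T)
    (Y : Fin n → Fin T → Bool → ℝ) (i : Fin n) (ω : Ω) : ℝ :=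
  influence (date ξ Y) (∫ ω', GammaTheta p P W ω' ∂P) (∫ ω', GammaWW p P W ω' ∂P)
    (∫ ω', GammaWY p P W Y ω' ∂P) (fun t => ∫ ω', GammaW p P W ω' t ∂P)
    (fun t => ∫ ω', GammaY p P W Y ω' t ∂P)
    (Theta p P W i ω) (vec (W i ω)) (obs (Y i) (W i ω))

/-- The plug-in version of `V_i`, with `τhat` for `τ*(ξ)` and `Γ` for `E[Γ]`. -/
def Vhat (p : Path T → ℝ) (P : Measure Ω) (W : Fin n → Ω → Path T)
    (Y : Fin n → Fin T → Bool → ℝ) (τhat : ℝ) (i : Fin n) (ω : Ω) : ℝ :=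
  influence τhat (GammaTheta p P W ω) (GammaWW p P W ω) (GammaWY p P W Y ω) (GammaW p P W ω)
    (GammaY p P W Y ω) (Theta p P W i ω) (vec (W i ω)) (obs (Y i) (W i ω))

/-- The variance estimate `σ̂² = (n - 1)⁻¹ ∑_i (V̂_i - mean of the V̂_j)²`. -/
def sigmaHatSq (p : Path T → ℝ) (P : Measure Ω) (W : Fin n → Ω → Path T)
    (Y : Fin n → Fin T → Bool → ℝ) (τhat : ℝ) (ω : Ω) : ℝ :=
  ((n : ℝ) - 1)⁻¹ *
    ∑ i, (Vhat p P W Y τhat i ω - (n : ℝ)⁻¹ * ∑ j, Vhat p P W Y τhat j ω) ^ 2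

/-- The `η`-quantile of the standard normal distribution. -/
def normalQuantile (η : ℝ) : ℝ := sInf {x : ℝ | η ≤ cdf (gaussianReal 0 1) x}

/-- The Wald interval `τ̂ ± z_{1-a/2} σ̂ / (√n D)`. -/
def waldInterval (p : Path T → ℝ) (P : Measure Ω) (W : Fin n → Ω → Path T)
    (Y : Fin n → Fin T → Bool → ℝ) (a τhat : ℝ) (ω : Ω) : Set ℝ :=
  Set.Icc
    (τhat - normalQuantile (1 - a / 2) * √(sigmaHatSq p P W Y τhat ω) / (√(n : ℝ) * DD p P W ω))
    (τhat + normalQuantile (1 - a / 2) * √(sigmaHatSq p P W Y τhat ω) / (√(n : ℝ) * DD p P W ω))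

end Estimator

end RIPW

end

open scoped Topology

namespace RIPW

/-! Profiling out `μ`, `α_i` and `λ_t` leaves a quadratic in `τ`. When `D > 0`, its vertex gives
`(τ̂ - τ*) D = N(Γ)`, where `N(Γ) = (Γ_wy - τ* Γ_ww) Γ_θ - Γ_w ⬝ᵥ (Γ_y - τ* Γ_w)` is a quadratic
form in the averages `Γ` (`exists_isRIPWEstimate_and_eq`, `normal_eq_eq_mul_DD`). Weighting by `Θ_i`
turns expectations over `W_i` into expectations under the common distribution `p`
(`integral_reshaped`), and the DATE equation then makes `N` vanish at `E[Γ]` (`integral_normal_eq`).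

Expand `N` around `E[Γ]`: the linear part is the average of the `V_i`, which has mean zero, and the
remainder is `N` of the deviations `Γ - E[Γ]` (`normal_eq_sub_pathAvg`). By Chebyshev, all
deviations are below `n ^ (-1/3)` with probability tending to one. The remainder is therefore
negligible after scaling by `√n`, and the central limit theorem for the `V_i`
(`eventually_lt_measureReal_abs_sum_lt`) governs the error.

Coverage is only bounded below because the individual means `E[V_i]` need not vanish: `σ̂²`
approximates the average second moment of the `V_i`, which is at least their average variance `v`.
It suffices that the standardized sum stays below some `b < z`; since `v ≥ ν₀`, the gap `z - b`
absorbs every vanishing error (`date_mem_waldInterval_of_deviationsLT`), and `b` may be taken as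
close to `z` as the target coverage demands. -/

/-! ### Central limit theorem for bounded triangular arrays. -/

/-- Products of complex numbers in the unit disc are Lipschitz in their factors. -/
theorem norm_prod_sub_prod_le {ι : Type*} (s : Finset ι) (f g : ι → ℂ) (hf : ∀ i ∈ s, ‖f i‖ ≤ 1)
    (hg : ∀ i ∈ s, ‖g i‖ ≤ 1) : ‖∏ i ∈ s, f i - ∏ i ∈ s, g i‖ ≤ ∑ i ∈ s, ‖f i - g i‖ := by
  classical
  induction s using Finset.induction_on with
  | empty => simp
  | insert a s ha ih =>
    have ih' := ih (fun i hi => hf i (Finset.mem_insert_of_mem hi))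
      (fun i hi => hg i (Finset.mem_insert_of_mem hi))
    rw [Finset.prod_insert ha, Finset.prod_insert ha, Finset.sum_insert ha]
    have h1 : f a * ∏ i ∈ s, f i - g a * ∏ i ∈ s, g i =
        f a * (∏ i ∈ s, f i - ∏ i ∈ s, g i) + (f a - g a) * ∏ i ∈ s, g i := by ring
    have h2 : ‖∏ i ∈ s, g i‖ ≤ 1 := by
      rw [norm_prod]
      exact Finset.prod_le_one (fun i _ => norm_nonneg _)
        fun i hi => hg i (Finset.mem_insert_of_mem hi)
    rw [h1]
    refine (norm_add_le _ _).trans ?_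
    rw [norm_mul, norm_mul]
    have h3 := mul_le_mul (hf a (Finset.mem_insert_self a s)) ih' (norm_nonneg _) zero_le_one
    have h4 := mul_le_mul_of_nonneg_left h2 (norm_nonneg (f a - g a))
    linarith

section CharFun

variable {Ω : Type*} [MeasurableSpace Ω] {P : Measure Ω} [IsProbabilityMeasure P]

/-- Second-order Taylor expansion: the zero mean kills the linear term, and the characteristic
function and the Gaussian factor each lie within `(|t| * B) ^ 3` of `1 - t² E[X²] / 2`. -/
theorem norm_charFun_sub_exp_le {X : Ω → ℝ} (hX : Measurable X) {B : ℝ} (hB : ∀ ω, |X ω| ≤ B)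
    (h0 : ∫ ω, X ω ∂P = 0) {t : ℝ} (ht : |t| * B ≤ 1) :
    ‖charFun (P.map X) t - Complex.exp (-(t ^ 2 * ∫ ω, X ω ^ 2 ∂P) / 2 : ℝ)‖ ≤
      2 * (|t| * B) ^ 3 := by
  have hB0 : 0 ≤ B := by
    obtain ⟨ω⟩ := nonempty_of_isProbabilityMeasure P
    exact (abs_nonneg _).trans (hB ω)
  set e : Ω → ℂ := fun ω => Complex.exp (t * X ω * Complex.I) with he
  set r : Ω → ℂ := fun ω => 1 + t * X ω * Complex.I - (t ^ 2 * X ω ^ 2 / 2 : ℝ) with hr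
  have hiX : Integrable X P := .of_bound hX.aestronglyMeasurable B (.of_forall hB)
  have hiX2 : Integrable (fun ω => X ω ^ 2) P := by
    refine .of_bound (by fun_prop) (B ^ 2) (.of_forall fun ω => ?_)
    rw [Real.norm_eq_abs, abs_pow]
    exact pow_le_pow_left₀ (abs_nonneg _) (hB ω) 2
  have hie : Integrable e P := by
    refine .of_bound (by fun_prop) 1 (.of_forall fun ω => ?_)
    have : e ω = Complex.exp ((t * X ω : ℝ) * Complex.I) := by simp [he]
    rw [this, Complex.norm_exp_ofReal_mul_I]
  have hi1 : Integrable (fun ω => (1 : ℂ) + t * X ω * Complex.I) P :=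
    (integrable_const _).add ((hiX.ofReal.const_mul _).mul_const _)
  have hi2 : Integrable (fun ω => ((t ^ 2 * X ω ^ 2 / 2 : ℝ) : ℂ)) P :=
    ((hiX2.const_mul _).div_const _).ofReal
  have hir : Integrable r P := hi1.sub hi2
  have hchar : charFun (P.map X) t = ∫ ω, e ω ∂P := by
    rw [charFun_apply_real, integral_map hX.aemeasurable (by fun_prop)]
  have hintr : ∫ ω, r ω ∂P = ((1 - t ^ 2 * (∫ ω, X ω ^ 2 ∂P) / 2 : ℝ) : ℂ) := by
    rw [hr, integral_sub hi1 hi2, integral_add (integrable_const _)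
      ((hiX.ofReal.const_mul _).mul_const _), integral_mul_const, integral_const_mul,
      integral_complex_ofReal, integral_complex_ofReal, h0, integral_div, integral_const_mul]
    simp
  have hpt : ∀ ω, ‖e ω - r ω‖ ≤ (|t| * B) ^ 3 := by
    intro ω
    have hn : ‖(t * X ω * Complex.I : ℂ)‖ ≤ |t| * B := by
      simp only [norm_mul, Complex.norm_real, Complex.norm_I, mul_one, Real.norm_eq_abs]
      exact mul_le_mul_of_nonneg_left (hB ω) (abs_nonneg _)
    have h := Complex.exp_bound (hn.trans ht) (n := 3) (by norm_num)
    have hs : ∑ m ∈ Finset.range 3, (t * X ω * Complex.I : ℂ) ^ m / m.factorial = r ω := by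
      simp only [Finset.sum_range_succ, Finset.sum_range_zero, hr, Nat.factorial]
      push_cast
      linear_combination (t * X ω : ℂ) ^ 2 / 2 * Complex.I_sq
    rw [hs] at h
    refine h.trans ?_
    have h3 := pow_le_pow_left₀ (norm_nonneg _) hn 3
    have h4 : (((3 : ℕ).succ : ℝ) * ((3 : ℕ).factorial * (3 : ℕ) : ℝ)⁻¹) ≤ 1 := by
      norm_num [Nat.factorial]
    calc _ ≤ ‖(t * X ω * Complex.I : ℂ)‖ ^ 3 * 1 :=
          mul_le_mul_of_nonneg_left h4 (by positivity)
      _ ≤ _ := by rw [mul_one]; exact h3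
  have h1 : ‖charFun (P.map X) t - ((1 - t ^ 2 * (∫ ω, X ω ^ 2 ∂P) / 2 : ℝ) : ℂ)‖ ≤
      (|t| * B) ^ 3 := by
    rw [hchar, ← hintr, ← integral_sub hie hir]
    simpa using norm_integral_le_of_norm_le_const (μ := P) (.of_forall hpt)
  have hv0 : 0 ≤ ∫ ω, X ω ^ 2 ∂P := integral_nonneg fun ω => sq_nonneg _
  have hvB : ∫ ω, X ω ^ 2 ∂P ≤ B ^ 2 := by
    have := integral_mono hiX2 (integrable_const (B ^ 2)) fun ω => by
      have := pow_le_pow_left₀ (abs_nonneg _) (hB ω) 2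
      simpa using this
    simpa using this
  set y : ℝ := t ^ 2 * (∫ ω, X ω ^ 2 ∂P) / 2 with hy
  have hu0 : 0 ≤ |t| * B := by positivity
  have hy0 : 0 ≤ y := by positivity
  have hyle : y ≤ (|t| * B) ^ 2 / 2 := by
    rw [hy, mul_pow, sq_abs]
    gcongr
  have h2 : ‖((1 - y : ℝ) : ℂ) - Complex.exp (-(t ^ 2 * ∫ ω, X ω ^ 2 ∂P) / 2 : ℝ)‖ ≤
      (|t| * B) ^ 3 := by
    have hyy : (-(t ^ 2 * ∫ ω, X ω ^ 2 ∂P) / 2 : ℝ) = -y := by rw [hy]; ring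
    rw [hyy, ← Complex.ofReal_exp, ← Complex.ofReal_sub, Complex.norm_real, norm_sub_rev]
    have hu2 : (|t| * B) ^ 2 ≤ 1 := pow_le_one₀ hu0 ht
    have := Real.norm_exp_sub_one_sub_id_le (x := -y) (by
      rw [norm_neg, Real.norm_of_nonneg hy0]; linarith)
    have h5 : Real.exp (-y) - (1 - y) = Real.exp (-y) - 1 - -y := by ring
    rw [h5]
    refine this.trans ?_
    rw [norm_neg, Real.norm_of_nonneg hy0]
    -- With `u = |t| * B ≤ 1`, the error `y²` is at most `u⁴ / 4`, hence at most `u³`.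
    have h6 : y ^ 2 ≤ ((|t| * B) ^ 2 / 2) ^ 2 := pow_le_pow_left₀ hy0 hyle 2
    have h7 : (|t| * B) ^ 4 ≤ (|t| * B) ^ 3 := pow_le_pow_of_le_one hu0 ht (by norm_num)
    nlinarith [pow_nonneg hu0 3]
  calc _ ≤ _ := norm_sub_le_norm_sub_add_norm_sub _ ((1 - y : ℝ) : ℂ) _
    _ ≤ _ := by linarith

end CharFun

/-- Central limit theorem for uniformly bounded, centred triangular arrays. -/
theorem eventually_lt_measureReal_abs_sum_lt {Ω : ℕ → Type*} [∀ n, MeasurableSpace (Ω n)]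
    {P : ∀ n, Measure (Ω n)} [∀ n, IsProbabilityMeasure (P n)] {X : ∀ n, Fin n → Ω n → ℝ}
    (hX : ∀ n i, Measurable (X n i)) (hindep : ∀ n, iIndepFun (X n) (P n)) {B : ℝ}
    (hB : ∀ n i ω, |X n i ω| ≤ B) (h0 : ∀ n i, ∫ ω, X n i ω ∂(P n) = 0) {v : ℕ → ℝ}
    (hv : ∀ n, v n = (n : ℝ)⁻¹ * ∑ i, ∫ ω, X n i ω ^ 2 ∂(P n)) {ν₀ : ℝ} (hν₀ : 0 < ν₀)
    (hvν : ∀ᶠ n in atTop, ν₀ ≤ v n) {b q : ℝ} (hq0 : 0 ≤ q)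
    (hq : q < (gaussianReal 0 1).real (Set.Ioo (-b) b)) :
    ∀ᶠ n : ℕ in atTop, q < (P n).real {ω | |∑ i, X n i ω| < b * (√n * √(v n))} := by
  set s : ℕ → ℝ := fun n => (√n * √(v n))⁻¹ with hs
  set Z : ∀ n, Ω n → ℝ := fun n ω => s n * ∑ i, X n i ω with hZ
  have hmS : ∀ n, Measurable fun ω => ∑ i, X n i ω := fun n => by fun_prop
  have hmZ : ∀ n, Measurable (Z n) := fun n => (hmS n).const_mul _
  have hs0 : ∀ n, 0 ≤ s n := fun n => by positivity
  have hB0 : 0 ≤ B := by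
    obtain ⟨ω⟩ := nonempty_of_isProbabilityMeasure (P 1)
    exact (abs_nonneg _).trans (hB 1 0 ω)
  have hsn : Tendsto (fun n : ℕ => (√(n : ℝ))⁻¹) atTop (𝓝 0) :=
    tendsto_inv_atTop_zero.comp (Real.tendsto_sqrt_atTop.comp tendsto_natCast_atTop_atTop)
  have hs_le : ∀ᶠ n : ℕ in atTop, s n ≤ (√(n : ℝ))⁻¹ * (√ν₀)⁻¹ := by
    filter_upwards [hvν] with n hn
    simp only [hs, mul_inv]
    gcongr
  let μ : ℕ → ProbabilityMeasure ℝ := fun n =>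
    ⟨(P n).map (Z n), Measure.isProbabilityMeasure_map (hmZ n).aemeasurable⟩
  let μ₀ : ProbabilityMeasure ℝ := ⟨gaussianReal 0 1, inferInstance⟩
  have hconv : Tendsto μ atTop (𝓝 μ₀) := by
    refine ProbabilityMeasure.tendsto_of_tendsto_charFun fun t => ?_
    have hg : charFun (gaussianReal 0 1) t = Complex.exp (-(t ^ 2) / 2 : ℝ) := by
      rw [charFun_gaussianReal]
      congr 1
      push_cast
      ring
    change Tendsto (fun n => charFun ((P n).map (Z n)) t) atTop (𝓝 (charFun (gaussianReal 0 1) t))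
    rw [hg, tendsto_iff_norm_sub_tendsto_zero]
    have hlim : Tendsto (fun n : ℕ => 2 * (|t| * (√ν₀)⁻¹ * B) ^ 3 * (√(n : ℝ))⁻¹) atTop (𝓝 0) := by
      simpa using hsn.const_mul (2 * (|t| * (√ν₀)⁻¹ * B) ^ 3)
    have hsmall : ∀ᶠ n : ℕ in atTop, |t| * (√ν₀)⁻¹ * B * (√(n : ℝ))⁻¹ ≤ 1 := by
      have : Tendsto (fun n : ℕ => |t| * (√ν₀)⁻¹ * B * (√(n : ℝ))⁻¹) atTop (𝓝 0) := by
        simpa using hsn.const_mul (|t| * (√ν₀)⁻¹ * B)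
      exact this.eventually_le_const one_pos
    refine squeeze_zero' (.of_forall fun n => norm_nonneg _) ?_ hlim
    filter_upwards [hvν, hs_le, hsmall, eventually_gt_atTop 0] with n hn hsn1 hsm hn0
    have hn0' : (0 : ℝ) < n := Nat.cast_pos.2 hn0
    have hvn : 0 < v n := hν₀.trans_le hn
    have hu : |s n * t| * B ≤ |t| * (√ν₀)⁻¹ * B * (√(n : ℝ))⁻¹ := by
      rw [abs_mul, abs_of_nonneg (hs0 n)]
      calc s n * |t| * B ≤ (√(n : ℝ))⁻¹ * (√ν₀)⁻¹ * |t| * B := by gcongr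
        _ = _ := by ring
    -- The scaled second moments sum to one, so the standard normal characteristic function splits
    -- into one Gaussian factor per unit.
    have hexp : Complex.exp (-(t ^ 2) / 2 : ℝ) =
        ∏ i, Complex.exp (-((s n * t) ^ 2 * ∫ ω, X n i ω ^ 2 ∂(P n)) / 2 : ℝ) := by
      rw [← Complex.exp_sum, ← Complex.ofReal_sum, ← Finset.sum_div, Finset.sum_neg_distrib,
        ← Finset.mul_sum]
      congr 4
      have hsum : ∑ i, ∫ ω, X n i ω ^ 2 ∂(P n) = n * v n := by
        rw [hv n]
        field_simp
      rw [hsum, hs]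
      simp only [mul_pow, inv_pow, Real.sq_sqrt hvn.le, Real.sq_sqrt hn0'.le]
      field_simp
    rw [hexp, charFun_map_mul_comp (hmS n).aemeasurable,
      (hindep n).charFun_map_fun_sum_eq_prod fun i => (hX n i).aemeasurable, Finset.prod_apply]
    have hprob : ∀ i, IsProbabilityMeasure ((P n).map (X n i)) := fun i =>
      Measure.isProbabilityMeasure_map (hX n i).aemeasurable
    refine (norm_prod_sub_prod_le _ _ _ (fun i _ => norm_charFun_le_one _) fun i _ => ?_).trans ?_
    · rw [← Complex.ofReal_exp, Complex.norm_real, Real.norm_of_nonneg (Real.exp_nonneg _),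
        Real.exp_le_one_iff]
      have : 0 ≤ ∫ ω, X n i ω ^ 2 ∂(P n) := integral_nonneg fun ω => sq_nonneg _
      have := mul_nonneg (sq_nonneg (s n * t)) this
      linarith
    -- Each of the `n` factors costs a cube of order `n ^ (-3/2)`, in total order `n ^ (-1/2)`.
    · calc _ ≤ ∑ i : Fin n, 2 * (|t| * (√ν₀)⁻¹ * B * (√(n : ℝ))⁻¹) ^ 3 := by
            refine Finset.sum_le_sum fun i _ => ?_
            refine (norm_charFun_sub_exp_le (hX n i) (hB n i) (h0 n i) (hu.trans hsm)).trans ?_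
            gcongr
        _ = _ := by
            rw [Finset.sum_const, Finset.card_univ, Fintype.card_fin, nsmul_eq_mul]
            have h8 : (√(n : ℝ))⁻¹ ^ 2 * n = 1 := by
              rw [inv_pow, Real.sq_sqrt hn0'.le, inv_mul_cancel₀ hn0'.ne']
            linear_combination 2 * (|t| * (√ν₀)⁻¹ * B) ^ 3 * (√(n : ℝ))⁻¹ * h8
  -- Only a lower bound on the probability is wanted, so the portmanteau inequality for open sets
  -- suffices.
  have hport := ProbabilityMeasure.le_liminf_measure_open_of_tendsto hconv
    (isOpen_Ioo (a := -b) (b := b))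
  have hq' : ENNReal.ofReal q < (gaussianReal 0 1) (Set.Ioo (-b) b) := by
    rwa [ENNReal.ofReal_lt_iff_lt_toReal hq0 (measure_ne_top _ _)]
  filter_upwards [eventually_lt_of_lt_liminf (hq'.trans_le hport), hvν, eventually_gt_atTop 0]
    with n hn hvn hn0
  have hn0' : (0 : ℝ) < n := Nat.cast_pos.2 hn0
  have hr : 0 < √n * √(v n) := by
    have := hν₀.trans_le hvn
    positivity
  change ENNReal.ofReal q < (P n).map (Z n) _ at hn
  rw [Measure.map_apply (hmZ n) measurableSet_Ioo] at hn
  have hset : Z n ⁻¹' Set.Ioo (-b) b = {ω | |∑ i, X n i ω| < b * (√n * √(v n))} := by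
    ext ω
    simp only [Set.mem_preimage, Set.mem_Ioo, Set.mem_ofPred_eq, ← abs_lt, hZ, hs]
    rw [abs_mul, abs_of_pos (inv_pos.2 hr), inv_mul_lt_iff₀ hr, mul_comm b]
  rw [hset] at hn
  rw [measureReal_def]
  exact (ENNReal.ofReal_lt_iff_lt_toReal hq0 (measure_ne_top _ _)).1 hn

/-! ### The centering projection `J`. -/

section Centering

variable {T : ℕ}

theorem J_mulVec_apply (v : Fin T → ℝ) (t : Fin T) :
    (J T *ᵥ v) t = v t - (T : ℝ)⁻¹ * ∑ s, v s := by
  simp only [J, Matrix.sub_mulVec, Matrix.one_mulVec, Matrix.smul_mulVec, Pi.sub_apply,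
    Pi.smul_apply, smul_eq_mul]
  simp [Matrix.mulVec, dotProduct]

theorem sum_J_mulVec (hT : T ≠ 0) (v : Fin T → ℝ) : ∑ t, (J T *ᵥ v) t = 0 := by
  have : (T : ℝ) ≠ 0 := Nat.cast_ne_zero.2 hT
  simp only [J_mulVec_apply, Finset.sum_sub_distrib, Finset.sum_const, Finset.card_univ,
    Fintype.card_fin, nsmul_eq_mul]
  field_simp
  ring

theorem dotProduct_J_mulVec (hT : T ≠ 0) (u v : Fin T → ℝ) :
    u ⬝ᵥ (J T *ᵥ v) = (J T *ᵥ u) ⬝ᵥ (J T *ᵥ v) := by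
  have h := sum_J_mulVec hT v
  simp only [dotProduct]
  simp only [J_mulVec_apply u, sub_mul, Finset.sum_sub_distrib, ← Finset.mul_sum, h, mul_zero,
    sub_zero]

theorem J_mulVec_dotProduct (hT : T ≠ 0) (u v : Fin T → ℝ) :
    (J T *ᵥ u) ⬝ᵥ v = u ⬝ᵥ (J T *ᵥ v) := by
  rw [dotProduct_J_mulVec hT u v, dotProduct_comm, dotProduct_J_mulVec hT v u, dotProduct_comm]

theorem J_mulVec_J_mulVec (hT : T ≠ 0) (v : Fin T → ℝ) : J T *ᵥ (J T *ᵥ v) = J T *ᵥ v := by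
  ext t
  rw [J_mulVec_apply (J T *ᵥ v), sum_J_mulVec hT, mul_zero, sub_zero]

end Centering

/-! ### Closed form of the weighted least-squares coefficient. -/

section LeastSquares

variable {n T : ℕ}

/-- Profiling out the unit effects of one unit. -/
theorem sum_sub_sub_sq (hT : T ≠ 0) (u l : Fin T → ℝ) (hl : ∑ t, l t = 0) (a : ℝ) :
    ∑ t, (u t - a - l t) ^ 2 =
      (J T *ᵥ u) ⬝ᵥ (J T *ᵥ u) - 2 * ((J T *ᵥ u) ⬝ᵥ l) + l ⬝ᵥ l +
        T * ((T : ℝ)⁻¹ * ∑ t, u t - a) ^ 2 := by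
  have hJ := sum_J_mulVec hT u
  have h : ∀ t, (u t - a - l t) ^ 2 = (J T *ᵥ u) t * (J T *ᵥ u) t - 2 * ((J T *ᵥ u) t * l t) +
      l t * l t + ((T : ℝ)⁻¹ * ∑ t, u t - a) ^ 2 +
      2 * ((T : ℝ)⁻¹ * ∑ t, u t - a) * ((J T *ᵥ u) t - l t) := by
    intro t
    rw [J_mulVec_apply]
    ring
  simp only [h, dotProduct, Finset.sum_add_distrib, Finset.sum_sub_distrib, ← Finset.mul_sum, hJ, hl,
    Finset.sum_const, Finset.card_univ, Fintype.card_fin, nsmul_eq_mul]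
  ring

variable (θ : Fin n → ℝ) (x y : Fin n → Fin T → ℝ)

/-- The weighted two-way objective after profiling out the unit and time effects. -/
noncomputable def profiled (τ : ℝ) : ℝ :=
  ∑ i, θ i * (y i ⬝ᵥ (J T *ᵥ y i)) - 2 * τ * ∑ i, θ i * (x i ⬝ᵥ (J T *ᵥ y i)) +
    τ ^ 2 * ∑ i, θ i * (x i ⬝ᵥ (J T *ᵥ x i)) -
    (∑ i, θ i)⁻¹ * ((∑ i, θ i • (J T *ᵥ y i) - τ • ∑ i, θ i • (J T *ᵥ x i)) ⬝ᵥ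
      (∑ i, θ i • (J T *ᵥ y i) - τ • ∑ i, θ i • (J T *ᵥ x i)))

/-- Completing the square, unit by unit and then in `l`. For nonnegative weights both added terms
are nonnegative, and they can be made zero, so `profiled` is the minimum over everything but `τ`. -/
theorem sum_residual_sq_eq (hT : T ≠ 0) (hθ : ∑ i, θ i ≠ 0) (τ μ : ℝ) (α : Fin n → ℝ)
    (l : Fin T → ℝ) (hl : ∑ t, l t = 0) :
    ∑ i, ∑ t, (y i t - μ - α i - l t - x i t * τ) ^ 2 * θ i =
      profiled θ x y τ + ∑ i, θ i * (T * ((T : ℝ)⁻¹ * ∑ t, (y i t - τ * x i t) - (μ + α i)) ^ 2) +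
        (∑ i, θ i) * ∑ t, (l t - (∑ i, θ i)⁻¹ *
          (∑ i, θ i • (J T *ᵥ y i) - τ • ∑ i, θ i • (J T *ᵥ x i)) t) ^ 2 := by
  set Z := ∑ i, θ i • (J T *ᵥ y i) - τ • ∑ i, θ i • (J T *ᵥ x i) with hZ
  set A := ∑ i, θ i with hA
  have hunit : ∀ i, ∑ t, (y i t - μ - α i - l t - x i t * τ) ^ 2 * θ i =
      θ i * ((y i ⬝ᵥ (J T *ᵥ y i)) - 2 * τ * (x i ⬝ᵥ (J T *ᵥ y i)) +
        τ ^ 2 * (x i ⬝ᵥ (J T *ᵥ x i))) - 2 * ((θ i • (J T *ᵥ y i) - τ • θ i • (J T *ᵥ x i)) ⬝ᵥ l) +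
      θ i * (l ⬝ᵥ l) + θ i * (T * ((T : ℝ)⁻¹ * ∑ t, (y i t - τ * x i t) - (μ + α i)) ^ 2) := by
    intro i
    have h := sum_sub_sub_sq hT (y i - τ • x i) l hl (μ + α i)
    rw [← Finset.sum_mul]
    have h2 : ∑ t, (y i t - μ - α i - l t - x i t * τ) ^ 2 =
        ∑ t, ((y i - τ • x i) t - (μ + α i) - l t) ^ 2 := by
      refine Finset.sum_congr rfl fun t _ => ?_
      simp only [Pi.sub_apply, Pi.smul_apply, smul_eq_mul]
      ring
    rw [h2, h, Matrix.mulVec_sub, Matrix.mulVec_smul]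
    simp only [sub_dotProduct, dotProduct_sub, smul_dotProduct, dotProduct_smul, smul_eq_mul,
      ← dotProduct_J_mulVec hT, dotProduct_comm (y i) (J T *ᵥ x i), J_mulVec_dotProduct hT,
      Pi.sub_apply, Pi.smul_apply]
    ring
  have hlast : A * ∑ t, (l t - A⁻¹ * Z t) ^ 2 = A * (l ⬝ᵥ l) - 2 * (Z ⬝ᵥ l) + A⁻¹ * (Z ⬝ᵥ Z) := by
    simp only [dotProduct, Finset.mul_sum, ← Finset.sum_sub_distrib, ← Finset.sum_add_distrib]
    refine Finset.sum_congr rfl fun t _ => ?_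
    field_simp
    ring
  have hZl : ∑ i, (θ i • (J T *ᵥ y i) - τ • θ i • (J T *ᵥ x i)) ⬝ᵥ l = Z ⬝ᵥ l := by
    rw [hZ, Finset.smul_sum, ← Finset.sum_sub_distrib, sum_dotProduct]
  rw [hlast, profiled, ← hZ, ← hA]
  simp only [hunit, Finset.sum_add_distrib, Finset.sum_sub_distrib, ← Finset.mul_sum, hZl,
    ← Finset.sum_mul, mul_add, mul_sub, ← hA]
  simp only [Finset.mul_sum, mul_left_comm]
  ring

/-- The profiled objective is quadratic in `τ` with leading coefficient `d / ∑ θ`; `hτ₀` places its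
vertex at `τ₀`. -/
theorem profiled_eq (hθ : ∑ i, θ i ≠ 0) {d τ₀ : ℝ}
    (hd : d = (∑ i, θ i * (x i ⬝ᵥ (J T *ᵥ x i))) * (∑ i, θ i) -
      (∑ i, θ i • (J T *ᵥ x i)) ⬝ᵥ (∑ i, θ i • (J T *ᵥ x i)))
    (hτ₀ : τ₀ * d = (∑ i, θ i * (x i ⬝ᵥ (J T *ᵥ y i))) * (∑ i, θ i) -
      (∑ i, θ i • (J T *ᵥ x i)) ⬝ᵥ (∑ i, θ i • (J T *ᵥ y i))) (τ : ℝ) :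
    profiled θ x y τ = profiled θ x y τ₀ + (∑ i, θ i)⁻¹ * d * (τ - τ₀) ^ 2 := by
  simp only [profiled, sub_dotProduct, dotProduct_sub, smul_dotProduct, dotProduct_smul,
    smul_eq_mul]
  rw [dotProduct_comm (∑ i, θ i • (J T *ᵥ y i)) (∑ i, θ i • (J T *ᵥ x i))]
  generalize (∑ i, θ i • (J T *ᵥ x i)) ⬝ᵥ (∑ i, θ i • (J T *ᵥ y i)) = c1 at *
  generalize (∑ i, θ i • (J T *ᵥ x i)) ⬝ᵥ (∑ i, θ i • (J T *ᵥ x i)) = c2 at *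
  generalize (∑ i, θ i • (J T *ᵥ y i)) ⬝ᵥ (∑ i, θ i • (J T *ᵥ y i)) = c3 at *
  generalize ∑ i, θ i * (x i ⬝ᵥ (J T *ᵥ y i)) = c4 at *
  generalize ∑ i, θ i * (x i ⬝ᵥ (J T *ᵥ x i)) = c5 at *
  generalize ∑ i, θ i * (y i ⬝ᵥ (J T *ᵥ y i)) = c6 at *
  generalize ∑ i, θ i = A at *
  field_simp
  subst hd
  linear_combination 2 * (τ - τ₀) * hτ₀

/-- The witness `l` is the weighted mean of the centred residuals; the residual means of the units
split into a grand mean `μ` and deviations `α`, so both constraints hold. -/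
theorem exists_sum_residual_sq_eq_profiled (hT : T ≠ 0) (hn : n ≠ 0) (hθ : ∑ i, θ i ≠ 0) (τ : ℝ) :
    ∃ (μ : ℝ) (α : Fin n → ℝ) (l : Fin T → ℝ), ∑ i, α i = 0 ∧ ∑ t, l t = 0 ∧
      ∑ i, ∑ t, (y i t - μ - α i - l t - x i t * τ) ^ 2 * θ i = profiled θ x y τ := by
  have hn' : (n : ℝ) ≠ 0 := Nat.cast_ne_zero.2 hn
  set m : Fin n → ℝ := fun i => (T : ℝ)⁻¹ * ∑ t, (y i t - τ * x i t)
  set l : Fin T → ℝ := fun t => (∑ i, θ i)⁻¹ *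
    (∑ i, θ i • (J T *ᵥ y i) - τ • ∑ i, θ i • (J T *ᵥ x i)) t
  have hl : ∑ t, l t = 0 := by
    have : ∀ z : Fin n → Fin T → ℝ, ∑ t, (∑ i, θ i • (J T *ᵥ z i)) t = 0 := by
      intro z
      simp only [Finset.sum_apply, Pi.smul_apply, smul_eq_mul]
      rw [Finset.sum_comm]
      simp [← Finset.mul_sum, sum_J_mulVec hT]
    simp only [l, ← Finset.mul_sum, Pi.sub_apply, Pi.smul_apply, Finset.sum_sub_distrib, smul_eq_mul,
      this]
    simp
  refine ⟨(n : ℝ)⁻¹ * ∑ i, m i, fun i => m i - (n : ℝ)⁻¹ * ∑ i, m i, l, ?_, hl, ?_⟩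
  · simp only [Finset.sum_sub_distrib, Finset.sum_const, Finset.card_univ, Fintype.card_fin,
      nsmul_eq_mul]
    field_simp
    ring
  · rw [sum_residual_sq_eq θ x y hT hθ τ _ _ l hl]
    simp [m, l]

end LeastSquares

section Estimate

variable {Ω : Type*} [MeasurableSpace Ω] {n T : ℕ}

/-- Positivity of `DD` makes the profiled quadratic strictly convex. Existence matters because the
estimator is only required to minimize when a minimizer exists. -/
theorem exists_isRIPWEstimate_and_eq (hT : T ≠ 0) (p : Path T → ℝ) (P : Measure Ω)
    (W : Fin n → Ω → Path T) (Y : Fin n → Fin T → Bool → ℝ) (ω : Ω)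
    (hθ : ∀ i, 0 ≤ Theta p P W i ω) (hD : 0 < DD p P W ω) :
    (∃ τ, IsRIPWEstimate p P W Y ω τ) ∧ ∀ τ, IsRIPWEstimate p P W Y ω τ →
      τ * DD p P W ω = GammaWY p P W Y ω * GammaTheta p P W ω -
        GammaW p P W ω ⬝ᵥ GammaY p P W Y ω := by
  set θ : Fin n → ℝ := fun i => Theta p P W i ω
  set x : Fin n → Fin T → ℝ := fun i => vec (W i ω)
  set y : Fin n → Fin T → ℝ := fun i => obs (Y i) (W i ω)
  have hn : n ≠ 0 := by
    rintro rfl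
    simp [DD, GammaTheta, GammaW] at hD
  have hn' : (n : ℝ) ≠ 0 := Nat.cast_ne_zero.2 hn
  set d := (∑ i, θ i * (x i ⬝ᵥ (J T *ᵥ x i))) * (∑ i, θ i) -
      (∑ i, θ i • (J T *ᵥ x i)) ⬝ᵥ (∑ i, θ i • (J T *ᵥ x i)) with hd
  set e := (∑ i, θ i * (x i ⬝ᵥ (J T *ᵥ y i))) * (∑ i, θ i) -
      (∑ i, θ i • (J T *ᵥ x i)) ⬝ᵥ (∑ i, θ i • (J T *ᵥ y i)) with he
  have hDD : DD p P W ω = ((n : ℝ)⁻¹) ^ 2 * d := by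
    simp only [DD, GammaWW, GammaTheta, GammaW, smul_dotProduct, dotProduct_smul, smul_eq_mul, hd,
      θ, x]
    ring
  have hNN : GammaWY p P W Y ω * GammaTheta p P W ω - GammaW p P W ω ⬝ᵥ GammaY p P W Y ω =
      ((n : ℝ)⁻¹) ^ 2 * e := by
    simp only [GammaWY, GammaTheta, GammaW, GammaY, smul_dotProduct, dotProduct_smul, smul_eq_mul,
      he, θ, x, y]
    ring
  have hd0 : 0 < d := by
    rw [hDD] at hD
    exact pos_of_mul_pos_right hD (by positivity)
  -- If the weights summed to zero, `d` would be minus a sum of squares.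
  have hθ0 : 0 < ∑ i, θ i := by
    refine lt_of_le_of_ne (Finset.sum_nonneg fun i _ => hθ i) fun h => ?_
    rw [hd, ← h, mul_zero, zero_sub, neg_pos] at hd0
    exact hd0.not_ge (Finset.sum_nonneg fun t _ => mul_self_nonneg _)
  have hquad := profiled_eq θ x y hθ0.ne' hd (τ₀ := e / d) (by field_simp; rfl)
  have hobj : ∀ τ μ α l, objective p P W Y ω τ μ α l =
      ∑ i, ∑ t, (y i t - μ - α i - l t - x i t * τ) ^ 2 * θ i := fun _ _ _ _ => rfl
  have hlow : ∀ τ μ α l, ∑ t, l t = 0 → profiled θ x y τ ≤ objective p P W Y ω τ μ α l := by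
    intro τ μ α l hl
    rw [hobj, sum_residual_sq_eq θ x y hT hθ0.ne' τ μ α l hl]
    have h1 : 0 ≤ ∑ i, θ i * (T * ((T : ℝ)⁻¹ * ∑ t, (y i t - τ * x i t) - (μ + α i)) ^ 2) :=
      Finset.sum_nonneg fun i _ => mul_nonneg (hθ i) (by positivity)
    have h2 : 0 ≤ (∑ i, θ i) * ∑ t, (l t - (∑ i, θ i)⁻¹ *
        (∑ i, θ i • (J T *ᵥ y i) - τ • ∑ i, θ i • (J T *ᵥ x i)) t) ^ 2 := by positivity
    linarith
  obtain ⟨μ, α, l, hα, hl, h⟩ := exists_sum_residual_sq_eq_profiled θ x y hT hn hθ0.ne' (e / d)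
  constructor
  · refine ⟨e / d, μ, α, l, hα, hl, fun τ' μ' α' l' _ hl' => ?_⟩
    rw [hobj, h]
    refine le_trans ?_ (hlow τ' μ' α' l' hl')
    rw [hquad τ']
    have : 0 ≤ (∑ i, θ i)⁻¹ * d * (τ' - e / d) ^ 2 := by positivity
    linarith
  · rintro τ ⟨μ', α', l', hα', hl', hmin⟩
    have h1 := (hlow τ μ' α' l' hl').trans (hmin (e / d) μ α l hα hl)
    rw [hobj (e / d), h, hquad τ] at h1
    have h2 : (τ - e / d) ^ 2 = 0 := by
      refine le_antisymm ?_ (sq_nonneg _)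
      have : 0 < (∑ i, θ i)⁻¹ * d := by positivity
      by_contra hcon
      have := mul_pos this (not_le.1 hcon)
      linarith
    have h3 : τ = e / d := by
      rw [sq_eq_zero_iff] at h2
      linarith
    rw [hNN, hDD, h3]
    field_simp

end Estimate

/-! ### Reshaped expectations and Chebyshev bounds for path averages. -/

section Expectation

variable {Ω : Type*} [MeasurableSpace Ω] {P : Measure Ω} [IsProbabilityMeasure P] {n T : ℕ}

theorem integrable_comp_path {W : Ω → Path T} (hW : Measurable W) (f : Path T → ℝ) :
    Integrable (fun ω => f (W ω)) P :=
  Integrable.comp_measurable (g := f) (Integrable.of_finite) hW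

theorem integral_comp_path {W : Ω → Path T} (hW : Measurable W) (f : Path T → ℝ) :
    ∫ ω, f (W ω) ∂P = ∑ w, propensity P W w * f w := by
  rw [← integral_map (f := f) hW.aemeasurable (measurable_of_finite f).aestronglyMeasurable,
    integral_fintype Integrable.of_finite]
  refine Finset.sum_congr rfl fun w _ => ?_
  rw [smul_eq_mul, map_measureReal_apply hW (measurableSet_singleton w)]
  rfl

/-- Reshaping: weighting by `p / π` turns expectations over `W` into expectations over `p`. -/
theorem integral_reshaped {W : Ω → Path T} (hW : Measurable W) {p : Path T → ℝ}
    (hp : ∀ w, p w ≠ 0 → propensity P W w ≠ 0) (f : Path T → ℝ) :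
    ∫ ω, p (W ω) / propensity P W (W ω) * f (W ω) ∂P = ∑ w, p w * f w := by
  rw [integral_comp_path hW fun w => p w / propensity P W w * f w]
  refine Finset.sum_congr rfl fun w _ => ?_
  by_cases h : p w = 0
  · simp [h]
  · have := hp w h
    field_simp

/-- The average over the units of functions of their paths. -/
noncomputable def pathAvg (W : Fin n → Ω → Path T) (f : Fin n → Path T → ℝ) (ω : Ω) : ℝ :=
  (n : ℝ)⁻¹ * ∑ i, f i (W i ω)

theorem inv_mul_sum_abs_le {f : Fin n → ℝ} {B : ℝ} (hB0 : 0 ≤ B) (hB : ∀ i, |f i| ≤ B) :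
    |(n : ℝ)⁻¹ * ∑ i, f i| ≤ B := by
  rcases Nat.eq_zero_or_pos n with rfl | hn
  · simpa using hB0
  have hn' : (0 : ℝ) < n := Nat.cast_pos.2 hn
  rw [abs_mul, abs_of_pos (inv_pos.2 hn'), inv_mul_le_iff₀ hn']
  refine (Finset.abs_sum_le_sum_abs _ _).trans ((Finset.sum_le_sum fun i _ => hB i).trans ?_)
  simp

theorem integrable_pathAvg {W : Fin n → Ω → Path T} (hW : ∀ i, Measurable (W i))
    (f : Fin n → Path T → ℝ) : Integrable (pathAvg W f) P :=
  (integrable_finsetSum _ fun i _ => integrable_comp_path (hW i) (f i)).const_mul _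

theorem integral_pathAvg {W : Fin n → Ω → Path T} (hW : ∀ i, Measurable (W i))
    (f : Fin n → Path T → ℝ) :
    ∫ ω, pathAvg W f ω ∂P = (n : ℝ)⁻¹ * ∑ i, ∫ ω, f i (W i ω) ∂P := by
  simp only [pathAvg]
  rw [integral_const_mul, integral_finsetSum _ fun i _ => integrable_comp_path (hW i) (f i)]

theorem abs_integral_pathAvg_le (W : Fin n → Ω → Path T) {f : Fin n → Path T → ℝ} {B : ℝ}
    (hB0 : 0 ≤ B) (hB : ∀ i w, |f i w| ≤ B) : |∫ ω, pathAvg W f ω ∂P| ≤ B := by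
  simpa using norm_integral_le_of_norm_le_const (μ := P) (f := pathAvg W f) (C := B)
    (.of_forall fun ω => inv_mul_sum_abs_le hB0 fun i => hB i _)

theorem variance_comp_path_le {W : Ω → Path T} (hW : Measurable W) {f : Path T → ℝ} {B : ℝ}
    (hB : ∀ w, |f w| ≤ B) : variance (fun ω => f (W ω)) P ≤ B ^ 2 := by
  have hm : Measurable fun ω => f (W ω) := (measurable_of_finite f).comp hW
  refine (variance_le_expectation_sq hm.aestronglyMeasurable).trans ?_
  have := integral_mono (μ := P) (integrable_comp_path hW fun w => f w ^ 2)
    (integrable_const (B ^ 2)) fun ω => by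
      have := pow_le_pow_left₀ (abs_nonneg _) (hB (W ω)) 2
      simpa using this
  simpa using this

/-- Chebyshev's inequality; independence makes the variances add. -/
theorem measure_pathAvg_sub_ge_le {W : Fin n → Ω → Path T} (hW : ∀ i, Measurable (W i))
    (hindep : iIndepFun W P) {f : Fin n → Path T → ℝ} {B : ℝ} (hB : ∀ i w, |f i w| ≤ B) {κ : ℝ}
    (hκ : 0 < κ) :
    P {ω | κ ≤ |pathAvg W f ω - ∫ ω', pathAvg W f ω' ∂P|} ≤
      ENNReal.ofReal (B ^ 2 / (n * κ ^ 2)) := by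
  have hm : ∀ i, Measurable fun ω => f i (W i ω) := fun i =>
    (measurable_of_finite (f i)).comp (hW i)
  have hL : ∀ i, MemLp (fun ω => f i (W i ω)) 2 P := fun i =>
    MemLp.of_bound (hm i).aestronglyMeasurable B (.of_forall fun ω => hB i _)
  have hind : iIndepFun (fun i ω => f i (W i ω)) P :=
    hindep.comp f fun i => measurable_of_finite (f i)
  have hLs : MemLp (pathAvg W f) 2 P := (memLp_finsetSum _ fun i _ => hL i).const_mul _
  refine (meas_ge_le_variance_div_sq hLs hκ).trans (ENNReal.ofReal_le_ofReal ?_)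
  have hvar : variance (pathAvg W f) P =
      (n : ℝ)⁻¹ ^ 2 * ∑ i, variance (fun ω => f i (W i ω)) P := by
    rw [← IndepFun.variance_sum (fun i _ => hL i) fun i _ j _ hij => hind.indepFun hij,
      ← variance_const_mul]
    congr 1
    ext ω
    simp [pathAvg]
  have hle : ∑ i, variance (fun ω => f i (W i ω)) P ≤ n * B ^ 2 := by
    refine (Finset.sum_le_sum fun i _ => variance_comp_path_le (hW i) (hB i)).trans ?_
    simp
  rw [hvar]
  rcases Nat.eq_zero_or_pos n with rfl | hn
  · simp
  have hn' : (0 : ℝ) < n := Nat.cast_pos.2 hn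
  calc _ ≤ (n : ℝ)⁻¹ ^ 2 * (n * B ^ 2) / κ ^ 2 := by gcongr
    _ = _ := by field_simp

end Expectation

/-! ### Events of probability tending to one. -/

section HighProbability

variable {Ω : ℕ → Type*} [∀ n, MeasurableSpace (Ω n)] {P : ∀ n, Measure (Ω n)}

/-- The events `E n` have outer probability of the complement tending to zero. -/
def HighProb (P : ∀ n, Measure (Ω n)) (E : ∀ n, Ω n → Prop) : Prop :=
  Tendsto (fun n => P n {ω | ¬ E n ω}) atTop (𝓝 0)

theorem HighProb.mono {E F : ∀ n, Ω n → Prop} (hE : HighProb P E)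
    (h : ∀ᶠ n in atTop, ∀ ω, E n ω → F n ω) : HighProb P F := by
  refine tendsto_of_tendsto_of_tendsto_of_le_of_le' tendsto_const_nhds hE
    (.of_forall fun n => zero_le) ?_
  filter_upwards [h] with n hn
  exact measure_mono fun ω hω hE => hω (hn ω hE)

theorem HighProb.and {E F : ∀ n, Ω n → Prop} (hE : HighProb P E) (hF : HighProb P F) :
    HighProb P fun n ω => E n ω ∧ F n ω := by
  have h := hE.add hF
  rw [add_zero] at h
  refine tendsto_of_tendsto_of_tendsto_of_le_of_le tendsto_const_nhds h (fun n => zero_le)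
    fun n => ?_
  refine le_trans (measure_mono ?_) (measure_union_le _ _)
  intro ω hω
  exact not_and_or.1 hω

theorem HighProb.forall {ι : Type*} [Fintype ι] {E : ι → ∀ n, Ω n → Prop}
    (hE : ∀ k, HighProb P (E k)) : HighProb P fun n ω => ∀ k, E k n ω := by
  have h := tendsto_finsetSum Finset.univ fun k (_ : k ∈ Finset.univ) => hE k
  rw [Finset.sum_const_zero] at h
  refine tendsto_of_tendsto_of_tendsto_of_le_of_le tendsto_const_nhds h (fun n => zero_le)
    fun n => ?_
  refine le_trans (measure_mono ?_) (measure_biUnion_finset_le _ _)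
  intro ω hω
  obtain ⟨k, hk⟩ := not_forall.1 hω
  exact Set.mem_biUnion (Finset.mem_coe.2 (Finset.mem_univ k)) hk

/-- Only monotonicity and subadditivity are used, so no event has to be measurable; the coverage
event involves an arbitrary choice of `τ̂`. -/
theorem HighProb.eventually_le_measureReal [∀ n, IsProbabilityMeasure (P n)]
    {E F G : ∀ n, Ω n → Prop} (hE : HighProb P E) {q r : ℝ} (hqr : q < r)
    (hF : ∀ᶠ n in atTop, r < (P n).real {ω | F n ω})
    (h : ∀ᶠ n in atTop, ∀ ω, E n ω → F n ω → G n ω) :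
    ∀ᶠ n in atTop, q ≤ (P n).real {ω | G n ω} := by
  have hE' : Tendsto (fun n => (P n).real {ω | ¬ E n ω}) atTop (𝓝 0) := by
    have := (ENNReal.tendsto_toReal ENNReal.zero_ne_top).comp hE
    rwa [ENNReal.toReal_zero] at this
  filter_upwards [hF, h, hE'.eventually_lt_const (sub_pos.2 hqr)] with n h1 h2 h3
  have h4 : (P n).real {ω | F n ω} ≤ (P n).real ({ω | G n ω} ∪ {ω | ¬ E n ω}) := by
    refine measureReal_mono fun ω hω => ?_
    by_cases hEω : E n ω
    · exact Or.inl (h2 ω hEω hω)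
    · exact Or.inr hEω
  have h5 := measureReal_union_le (μ := P n) {ω | G n ω} {ω | ¬ E n ω}
  linarith

variable {T : ℕ}

theorem highProb_pathAvg_sub_lt [∀ n, IsProbabilityMeasure (P n)] {W : ∀ n, Fin n → Ω n → Path T}
    (hW : ∀ n i, Measurable (W n i)) (hindep : ∀ n, iIndepFun (W n) (P n))
    {f : ∀ n, Fin n → Path T → ℝ} {B : ℝ} (hB : ∀ n i w, |f n i w| ≤ B) {κ : ℕ → ℝ}
    (hκ : ∀ n, 0 < n → 0 < κ n) (hκn : Tendsto (fun n : ℕ => n * κ n ^ 2) atTop atTop) :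
    HighProb P fun n ω =>
      |pathAvg (W n) (f n) ω - ∫ ω', pathAvg (W n) (f n) ω' ∂(P n)| < κ n := by
  have hlim : Tendsto (fun n : ℕ => ENNReal.ofReal (B ^ 2 / (n * κ n ^ 2))) atTop (𝓝 0) := by
    rw [← ENNReal.ofReal_zero]
    exact (ENNReal.continuous_ofReal.tendsto 0).comp (hκn.const_div_atTop (B ^ 2))
  refine tendsto_of_tendsto_of_tendsto_of_le_of_le' tendsto_const_nhds hlim
    (.of_forall fun n => zero_le) ?_
  filter_upwards [eventually_gt_atTop 0] with n hn
  simp only [not_lt]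
  exact measure_pathAvg_sub_ge_le (hW n) (hindep n) (hB n) (hκ n hn)

end HighProbability

/-! ### Algebra of the DATE equation and positivity of the limit of `D`. -/

section DATE

variable {n T : ℕ} {p : Path T → ℝ}

/-- The limit of `D`: the `p`-expectation of `‖J (W - E W)‖²`, written as a covariance. -/
noncomputable def limitDD (p : Path T → ℝ) : ℝ :=
  ∑ w, p w * (vec w ⬝ᵥ (J T *ᵥ vec w)) - (J T *ᵥ meanPath p) ⬝ᵥ (J T *ᵥ meanPath p)

theorem J_mulVec_meanPath (p : Path T → ℝ) :
    J T *ᵥ meanPath p = ∑ w, p w • (J T *ᵥ vec w) := by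
  simp only [meanPath, Matrix.mulVec_sum, Matrix.mulVec_smul]

theorem sum_mul_dotProduct_sub_meanPath (hp : ∑ w, p w = 1) (v : Fin T → ℝ) :
    ∑ w, p w * ((vec w - meanPath p) ⬝ᵥ v) = 0 := by
  simp only [sub_dotProduct, mul_sub, Finset.sum_sub_distrib, ← Finset.sum_mul, hp, one_mul]
  simp only [meanPath, sum_dotProduct, smul_dotProduct, smul_eq_mul, sub_self]

theorem limitDD_eq (hT : T ≠ 0) (p : Path T → ℝ) :
    limitDD p = ∑ w, p w * (vec w ⬝ᵥ (J T *ᵥ (vec w - meanPath p))) := by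
  simp only [limitDD, Matrix.mulVec_sub, dotProduct_sub, mul_sub, Finset.sum_sub_distrib]
  congr 1
  rw [J_mulVec_dotProduct hT, J_mulVec_J_mulVec hT]
  nth_rw 1 [meanPath]
  simp only [sum_dotProduct, smul_dotProduct, smul_eq_mul]

/-- Centering the left factor too costs nothing, since the right factor has mean zero under `p`;
this exhibits an average of squared norms. -/
theorem limitDD_eq_sum_sq (hT : T ≠ 0) (hp : ∑ w, p w = 1) :
    limitDD p = ∑ w, p w *
      ((J T *ᵥ (vec w - meanPath p)) ⬝ᵥ (J T *ᵥ (vec w - meanPath p))) := by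
  have h := sum_mul_dotProduct_sub_meanPath hp (J T *ᵥ meanPath p)
  rw [limitDD_eq hT, ← sub_zero (∑ w, p w * (vec w ⬝ᵥ _))]
  nth_rw 1 [← h]
  rw [← Finset.sum_sub_distrib]
  refine Finset.sum_congr rfl fun w _ => ?_
  rw [← dotProduct_J_mulVec hT]
  simp only [sub_dotProduct, Matrix.mulVec_sub, dotProduct_sub]
  rw [dotProduct_comm (meanPath p) (J T *ᵥ vec w), J_mulVec_dotProduct hT]
  ring

theorem vec_injective : Function.Injective (vec (T := T)) := by
  intro w w' h
  ext t
  have := congrFun h t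
  simp only [vec] at this
  cases hw : w t <;> cases hw' : w' t <;> simp_all

/-- Two paths that agree after centering, one of them not constant, are equal. -/
theorem eq_of_J_mulVec_eq {w w' : Path T} (h0 : w ≠ fun _ => false) (h1 : w ≠ fun _ => true)
    (h : J T *ᵥ vec w = J T *ᵥ vec w') : w' = w := by
  obtain ⟨s, hs⟩ := Function.ne_iff.1 h0
  obtain ⟨t, ht⟩ := Function.ne_iff.1 h1
  have hs' : vec w s = 1 := by simp_all [vec]
  have ht' : vec w t = 0 := by simp_all [vec]
  set k := (T : ℝ)⁻¹ * ∑ r, vec w r - (T : ℝ)⁻¹ * ∑ r, vec w' r with hk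
  have hdiff : ∀ r, vec w r - vec w' r = k := by
    intro r
    have := congrFun h r
    rw [J_mulVec_apply, J_mulVec_apply] at this
    rw [hk]
    linarith
  have h01 : ∀ r, vec w' r = 0 ∨ vec w' r = 1 := by
    intro r
    cases hr : w' r <;> simp [vec, hr]
  -- Position `s` forces `k` into `{0, 1}` and position `t` into `{0, -1}`.
  have hk0 : k = 0 := by
    have h1 := hdiff s
    have h2 := hdiff t
    rcases h01 s with h3 | h3 <;> rcases h01 t with h4 | h4 <;>
      rw [hs', h3] at h1 <;> rw [ht', h4] at h2 <;> linarith
  refine vec_injective (funext fun r => ?_)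
  have := hdiff r
  rw [hk0] at this
  linarith

/-- If it vanished, `J W` would be constant on the support. A nonconstant path is determined by its
centering, so the support would be a single path. -/
theorem limitDD_pos (hT : T ≠ 0) {S : Set (Path T)} (hp : IsReshapedDistribution p S)
    (hS : S.Nontrivial) (hne : ∃ w ∈ S, w ≠ (fun _ => false) ∧ w ≠ (fun _ => true)) :
    0 < limitDD p := by
  have hsq : ∀ v : Fin T → ℝ, 0 ≤ v ⬝ᵥ v := fun v =>
    Finset.sum_nonneg fun t _ => mul_self_nonneg _
  rw [limitDD_eq_sum_sq hT hp.sum_eq_one]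
  refine lt_of_le_of_ne (Finset.sum_nonneg fun w _ => mul_nonneg (hp.nonneg w) (hsq _)) fun h => ?_
  have hz := (Finset.sum_eq_zero_iff_of_nonneg fun w _ => mul_nonneg (hp.nonneg w) (hsq _)).1 h.symm
  have hzero : ∀ w ∈ S, J T *ᵥ vec w = J T *ᵥ meanPath p := by
    intro w hw
    rw [← hp.support_eq] at hw
    have h1 := (mul_eq_zero.1 (hz w (Finset.mem_univ w))).resolve_left hw
    rw [dotProduct_self_eq_zero, Matrix.mulVec_sub] at h1
    exact sub_eq_zero.1 h1
  obtain ⟨w, hw, hw0, hw1⟩ := hne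
  obtain ⟨w', hw', hww'⟩ := hS.exists_ne w
  exact hww' (eq_of_J_mulVec_eq hw0 hw1 ((hzero w hw).trans (hzero w' hw').symm))

/-- The DATE equation paired with a vector of effects. -/
theorem DATEEquation.sum_eq {ξ : Fin T → ℝ} (h : DATEEquation p ξ) (hT : T ≠ 0) (τ : Fin T → ℝ) :
    ∑ w, p w * ((J T *ᵥ (vec w - meanPath p)) ⬝ᵥ fun t => τ t * vec w t) =
      (∑ t, ξ t * τ t) * limitDD p := by
  -- Coordinate `t` of the DATE equation; the factor multiplying `ξ t` is `limitDD p` by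
  -- `limitDD_eq`.
  have ht : ∀ t, ∑ w, p w * (vec w t * (J T *ᵥ (vec w - meanPath p)) t) = ξ t * limitDD p := by
    intro t
    have h1 := congrFun h t
    simp only [Finset.sum_apply, Pi.smul_apply, smul_eq_mul, Matrix.sub_mulVec, Pi.sub_apply,
      Matrix.mulVec_diagonal, Matrix.vecMulVec_mulVec, mul_sub, Finset.sum_sub_distrib,
      Pi.zero_apply] at h1
    rw [limitDD_eq hT, Finset.mul_sum]
    rw [sub_eq_zero] at h1
    rw [h1]
    refine Finset.sum_congr rfl fun w _ => ?_
    simp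
    ring
  calc _ = ∑ t, τ t * ∑ w, p w * (vec w t * (J T *ᵥ (vec w - meanPath p)) t) := by
        simp only [dotProduct, Finset.mul_sum]
        rw [Finset.sum_comm]
        refine Finset.sum_congr rfl fun t _ => Finset.sum_congr rfl fun w _ => ?_
        ring
    _ = _ := by
        simp only [ht, Finset.sum_mul]
        refine Finset.sum_congr rfl fun t _ => ?_
        ring

/-- The population version of the least-squares normal equation holds at `τ*(ξ)`. -/
theorem DATEEquation.population_normal_eq {ξ : Fin T → ℝ} (h : DATEEquation p ξ) (hT : T ≠ 0)
    (hp : ∑ w, p w = 1) (Y : Fin n → Fin T → Bool → ℝ) :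
    (n : ℝ)⁻¹ * ∑ i, ∑ w, p w * (vec w ⬝ᵥ (J T *ᵥ obs (Y i) w)) -
      (J T *ᵥ meanPath p) ⬝ᵥ (fun t => (n : ℝ)⁻¹ * ∑ i, ∑ w, p w * (J T *ᵥ obs (Y i) w) t) =
      date ξ Y * limitDD p := by
  have hunit : ∀ y : Fin T → Bool → ℝ, ∑ w, p w * (vec w ⬝ᵥ (J T *ᵥ obs y w)) -
      (J T *ᵥ meanPath p) ⬝ᵥ (fun t => ∑ w, p w * (J T *ᵥ obs y w) t) =
      (∑ t, ξ t * (y t true - y t false)) * limitDD p := by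
    intro y
    rw [← h.sum_eq hT]
    have h1 : (J T *ᵥ meanPath p) ⬝ᵥ (fun t => ∑ w, p w * (J T *ᵥ obs y w) t) =
        ∑ w, p w * (meanPath p ⬝ᵥ (J T *ᵥ obs y w)) := by
      simp only [dotProduct_J_mulVec hT (meanPath p)]
      simp only [dotProduct, Finset.mul_sum]
      rw [Finset.sum_comm]
      refine Finset.sum_congr rfl fun t _ => Finset.sum_congr rfl fun w _ => ?_
      ring
    -- Untreated outcomes do not depend on the path, so they pair to zero with the centred path and
    -- only the effects remain.
    have h2 := sum_mul_dotProduct_sub_meanPath hp (J T *ᵥ fun t => y t false)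
    rw [h1, ← Finset.sum_sub_distrib, ← sub_zero (∑ w, (_ - _)), ← h2, ← Finset.sum_sub_distrib]
    refine Finset.sum_congr rfl fun w _ => ?_
    have h3 : obs y w = (fun t => y t false) + fun t => (y t true - y t false) * vec w t := by
      ext t
      simp only [obs, Pi.add_apply]
      ring
    rw [J_mulVec_dotProduct hT, h3, Matrix.mulVec_add, dotProduct_add, dotProduct_add,
      sub_dotProduct, sub_dotProduct]
    ring
  have h2 : (J T *ᵥ meanPath p) ⬝ᵥ (fun t => (n : ℝ)⁻¹ * ∑ i, ∑ w, p w * (J T *ᵥ obs (Y i) w) t) =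
      (n : ℝ)⁻¹ * ∑ i, (J T *ᵥ meanPath p) ⬝ᵥ (fun t => ∑ w, p w * (J T *ᵥ obs (Y i) w) t) := by
    simp only [dotProduct, Finset.mul_sum]
    rw [Finset.sum_comm]
    refine Finset.sum_congr rfl fun t _ => Finset.sum_congr rfl fun w _ =>
      Finset.sum_congr rfl fun _ _ => ?_
    ring
  rw [h2, ← mul_sub, ← Finset.sum_sub_distrib]
  simp only [hunit, ← Finset.sum_mul, ← mul_assoc, date]
  congr 1
  rw [Finset.sum_comm]
  simp only [Finset.mul_sum]
  refine Finset.sum_congr rfl fun t _ => Finset.sum_congr rfl fun i _ => ?_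
  ring

end DATE

/-! ### Normal quantiles and symmetric intervals. -/

section Quantile

/-- The infimum inherits the inequality because the cdf is right continuous. -/
theorem le_cdf_normalQuantile {η : ℝ} (hη : η < 1) :
    η ≤ cdf (gaussianReal 0 1) (normalQuantile η) := by
  set s : Set ℝ := {x : ℝ | η ≤ cdf (gaussianReal 0 1) x} with hs
  have hne : s.Nonempty :=
    ((tendsto_cdf_atTop (gaussianReal 0 1)).eventually_const_le hη).exists
  have hright : Tendsto (cdf (gaussianReal 0 1)) (𝓝[>] (normalQuantile η))
      (𝓝 (cdf (gaussianReal 0 1) (normalQuantile η))) :=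
    ((cdf (gaussianReal 0 1)).right_continuous _).mono_left (nhdsWithin_mono _ Set.Ioi_subset_Ici_self)
  refine ge_of_tendsto hright ?_
  filter_upwards [self_mem_nhdsWithin] with x hx
  obtain ⟨y, hy, hyx⟩ := exists_lt_of_csInf_lt hne (show sInf s < x from hx)
  exact le_trans (show η ≤ cdf (gaussianReal 0 1) y from hy) (monotone_cdf _ hyx.le)

/-- By symmetry and absence of atoms both tails have mass `1 - cdf z`. Covering the line by the
tails and the interval requires no sign of `z`. -/
theorem two_mul_cdf_sub_one_le (z : ℝ) :
    2 * cdf (gaussianReal 0 1) z - 1 ≤ (gaussianReal 0 1).real (Set.Ioo (-z) z) := by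
  set μ := gaussianReal 0 1 with hμ
  have : NullSingletonClass μ := nullSingletonClass_gaussianReal one_ne_zero
  have hmap : μ.map (fun x => -x) = μ := by
    rw [hμ, gaussianReal_map_neg, neg_zero]
  have hIoi : μ.real (Set.Ioi z) = 1 - cdf μ z := by
    rw [cdf_eq_real, ← Set.compl_Iic, probReal_compl_eq_one_sub measurableSet_Iic]
  have hIci : μ.real (Set.Ici z) = 1 - cdf μ z := by
    rw [← hIoi]
    exact measureReal_congr Ioi_ae_eq_Ici.symm
  have hIic : μ.real (Set.Iic (-z)) = 1 - cdf μ z := by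
    rw [← hIci]
    nth_rw 2 [← hmap]
    rw [map_measureReal_apply (by fun_prop) measurableSet_Ici]
    congr 1
    ext x
    simp only [Set.mem_Iic, Set.mem_preimage, Set.mem_Ici]
    exact le_neg
  have hcov : (Set.univ : Set ℝ) ⊆ (Set.Iic (-z) ∪ Set.Ioo (-z) z) ∪ Set.Ici z := by
    intro x _
    rcases le_or_gt x (-z) with h | h
    · exact Or.inl (Or.inl h)
    · rcases lt_or_ge x z with h' | h'
      · exact Or.inl (Or.inr ⟨h, h'⟩)
      · exact Or.inr h'
  have h1 := measureReal_mono (μ := μ) hcov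
  have h2 := measureReal_union_le (μ := μ) (Set.Iic (-z) ∪ Set.Ioo (-z) z) (Set.Ici z)
  have h3 := measureReal_union_le (μ := μ) (Set.Iic (-z)) (Set.Ioo (-z) z)
  rw [probReal_univ] at h1
  linarith

/-- Continuity from below. The gap `z - b` is what later pays for the remainders. -/
theorem exists_lt_of_lt_measureReal_Ioo (μ : Measure ℝ) [IsProbabilityMeasure μ] {z r : ℝ}
    (h : r < μ.real (Set.Ioo (-z) z)) : ∃ b < z, r < μ.real (Set.Ioo (-b) b) := by
  set b : ℕ → ℝ := fun k => z - 1 / ((k : ℝ) + 1) with hb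
  have hbz : ∀ k, b k < z := fun k => sub_lt_self _ (by positivity)
  have hmono : Monotone fun k => Set.Ioo (-b k) (b k) := by
    intro k l hkl
    have : b k ≤ b l := sub_le_sub_left (one_div_le_one_div_of_le (by positivity) (by gcongr)) _
    exact Set.Ioo_subset_Ioo (neg_le_neg this) this
  have hlimb : Tendsto b atTop (𝓝 z) := by
    simpa only [sub_zero] using tendsto_one_div_add_atTop_nhds_zero_nat.const_sub z
  have hunion : ⋃ k, Set.Ioo (-b k) (b k) = Set.Ioo (-z) z := by
    refine Set.Subset.antisymm (Set.iUnion_subset fun k =>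
      Set.Ioo_subset_Ioo (neg_le_neg (hbz k).le) (hbz k).le) fun x hx => ?_
    have : |x| < z := abs_lt.2 hx
    obtain ⟨k, hk⟩ := (hlimb.eventually_const_lt this).exists
    exact Set.mem_iUnion.2 ⟨k, abs_lt.1 hk⟩
  have hlim := tendsto_measure_iUnion_atTop (μ := μ) hmono
  rw [hunion] at hlim
  have hlim' : Tendsto (fun k => μ.real (Set.Ioo (-b k) (b k))) atTop
      (𝓝 (μ.real (Set.Ioo (-z) z))) :=
    (ENNReal.tendsto_toReal (measure_ne_top _ _)).comp hlim
  obtain ⟨k, hk⟩ := (hlim'.eventually_const_lt h).exists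
  exact ⟨b k, hbz k, hk⟩

end Quantile

/-! ### Stability of the sample variance and of its square root. -/

section Analysis

variable {n T : ℕ}

/-- The sample variance is stable under uniform perturbations of a bounded sample. -/
theorem le_sample_variance {u v : Fin n → ℝ} {B ε : ℝ} (hn : 1 < n) (hu : ∀ i, |u i| ≤ B)
    (huv : ∀ i, |v i - u i| ≤ ε) :
    (n : ℝ)⁻¹ * ∑ i, u i ^ 2 - ((n : ℝ)⁻¹ * ∑ i, u i) ^ 2 - 8 * B * ε ≤
      ((n : ℝ) - 1)⁻¹ * ∑ i, (v i - (n : ℝ)⁻¹ * ∑ j, v j) ^ 2 := by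
  have hn' : (1 : ℝ) < n := by exact_mod_cast hn
  have hn0 : (0 : ℝ) < n := by linarith
  have hB0 : 0 ≤ B := (abs_nonneg _).trans (hu ⟨0, by omega⟩)
  have hε0 : 0 ≤ ε := (abs_nonneg _).trans (huv ⟨0, by omega⟩)
  set m := (n : ℝ)⁻¹ * ∑ i, u i with hm
  set k := (n : ℝ)⁻¹ * ∑ i, v i with hk
  have hmB : |m| ≤ B := inv_mul_sum_abs_le hB0 hu
  have hkm : |k - m| ≤ ε := by
    rw [hk, hm, ← mul_sub, ← Finset.sum_sub_distrib]
    exact inv_mul_sum_abs_le hε0 huv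
  -- The constant is `2 * (2 * B) * (2 * ε)`, from the cross term; the leftover square is
  -- nonnegative.
  have hpt : ∀ i, (u i - m) ^ 2 - 8 * B * ε ≤ (v i - k) ^ 2 := by
    intro i
    have h1 : |u i - m| ≤ 2 * B := (abs_sub _ _).trans (by linarith [hu i])
    have h2 : |(v i - u i) - (k - m)| ≤ 2 * ε := (abs_sub _ _).trans (by linarith [huv i])
    have h3 : |(u i - m) * ((v i - u i) - (k - m))| ≤ 2 * B * (2 * ε) := by
      rw [abs_mul]
      exact mul_le_mul h1 h2 (abs_nonneg _) (by positivity)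
    have h4 := neg_le_of_abs_le h3
    have h5 : (v i - k) ^ 2 = (u i - m) ^ 2 + 2 * ((u i - m) * ((v i - u i) - (k - m))) +
      ((v i - u i) - (k - m)) ^ 2 := by ring
    nlinarith [sq_nonneg ((v i - u i) - (k - m))]
  have hsum : ∑ i, (u i - m) ^ 2 = ∑ i, u i ^ 2 - n * m ^ 2 := by
    have h1 : ∑ i, u i = n * m := by rw [hm]; field_simp
    have h2 : ∀ i, (u i - m) ^ 2 = u i ^ 2 - 2 * m * u i + m ^ 2 := fun i => by ring
    simp only [h2, Finset.sum_add_distrib, Finset.sum_sub_distrib, ← Finset.mul_sum, h1,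
      Finset.sum_const, Finset.card_univ, Fintype.card_fin, nsmul_eq_mul]
    ring
  have hle : ∑ i, u i ^ 2 - n * m ^ 2 - n * (8 * B * ε) ≤ ∑ i, (v i - k) ^ 2 := by
    have := Finset.sum_le_sum fun i (_ : i ∈ Finset.univ) => hpt i
    simpa [Finset.sum_sub_distrib, hsum] using this
  have hS : 0 ≤ ∑ i, (v i - k) ^ 2 := Finset.sum_nonneg fun i _ => sq_nonneg _
  calc _ = (n : ℝ)⁻¹ * (∑ i, u i ^ 2 - n * m ^ 2 - n * (8 * B * ε)) := by field_simp
    _ ≤ (n : ℝ)⁻¹ * ∑ i, (v i - k) ^ 2 := by gcongr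
    -- Dividing by `n - 1` instead of `n` only enlarges the estimate.
    _ ≤ _ := by
      gcongr
      linarith

/-- A deficit `ε` in the variance lowers its root by at most `ε / √ν₀`. Adding the `ε` on the left,
the total loss is `ε * K`, and `ε` is chosen so that this is at most `√ν₀ * (z - b)`. -/
theorem exists_mul_add_le_mul_sqrt {ν₀ b z : ℝ} (hν₀ : 0 < ν₀) (hbz : b < z) (hz : 0 ≤ z) :
    ∃ ε > 0, ∀ v s : ℝ, ν₀ ≤ v → v - ε ≤ s → b * √v + ε ≤ z * √s := by
  have hr : 0 < √ν₀ := Real.sqrt_pos.2 hν₀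
  set K := 1 + z / √ν₀ with hK
  have hK0 : 0 < K := by positivity
  refine ⟨min ν₀ (√ν₀ * (z - b) / K), lt_min hν₀ (by have := sub_pos.2 hbz; positivity), ?_⟩
  intro v s hv hs
  set ε := min ν₀ (√ν₀ * (z - b) / K) with hε
  have h1 : ε ≤ ν₀ := min_le_left _ _
  have h2 : ε * K ≤ √ν₀ * (z - b) := (le_div_iff₀ hK0).1 (min_le_right _ _)
  have hε0 : 0 < ε := lt_min hν₀ (by have := sub_pos.2 hbz; positivity)
  have hσ : √ν₀ ≤ √v := Real.sqrt_le_sqrt hv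
  have hv0 : √v ^ 2 = v := Real.sq_sqrt (hν₀.le.trans hv)
  have hr2 : √ν₀ ^ 2 = ν₀ := Real.sq_sqrt hν₀.le
  have he : ε / √ν₀ ≤ √ν₀ := by
    rw [div_le_iff₀ hr]
    nlinarith
  have hs' : √v - ε / √ν₀ ≤ √s := by
    refine Real.le_sqrt_of_sq_le (le_trans ?_ hs)
    set e := ε / √ν₀ with hedef
    have h3 : ε = e * √ν₀ := by rw [hedef]; field_simp
    have he0 : 0 ≤ e := by positivity
    rw [h3]
    nlinarith [mul_nonneg he0 (sub_nonneg.2 (he.trans hσ)), mul_nonneg he0 (sub_nonneg.2 hσ)]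
  have h4 : z * (√v - ε / √ν₀) ≤ z * √s := mul_le_mul_of_nonneg_left hs' hz
  have h5 : ε + z * (ε / √ν₀) ≤ √ν₀ * (z - b) := by
    refine le_trans (le_of_eq ?_) h2
    rw [hK]
    field_simp
  have h6 : √ν₀ * (z - b) ≤ √v * (z - b) := mul_le_mul_of_nonneg_right hσ (sub_pos.2 hbz).le
  nlinarith

end Analysis

/-! ### Uniform bounds and continuity by compactness. -/

section Influence

variable {T : ℕ}

/-- The arguments of `influence` as one point of a finite-dimensional space. -/
abbrev InfluenceArgs (T : ℕ) : Type :=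
  (ℝ × ℝ × ℝ × ℝ) × ((Fin T → ℝ) × (Fin T → ℝ)) × (ℝ × (Fin T → ℝ) × (Fin T → ℝ))

/-- `influence` as a function of one point. -/
noncomputable def influenceAt (z : InfluenceArgs T) : ℝ :=
  influence z.1.1 z.1.2.1 z.1.2.2.1 z.1.2.2.2 z.2.1.1 z.2.1.2 z.2.2.1 z.2.2.2.1 z.2.2.2.2

theorem continuous_influenceAt : Continuous (influenceAt (T := T)) := by
  unfold influenceAt influence
  fun_prop

theorem exists_abs_influenceAt_le (T : ℕ) (R : ℝ) :
    ∃ B, ∀ z : InfluenceArgs T, ‖z‖ ≤ R → |influenceAt z| ≤ B := by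
  obtain ⟨B, hB⟩ := (isCompact_closedBall (0 : InfluenceArgs T) R).exists_bound_of_continuousOn
    continuous_influenceAt.continuousOn
  exact ⟨B, fun z hz => hB z (mem_closedBall_zero_iff.2 hz)⟩

/-- The arguments live in a space whose dimension is independent of the number of units, so one `δ`
serves all `n` and all units. -/
theorem exists_abs_influenceAt_sub_le (T : ℕ) (R : ℝ) {ε : ℝ} (hε : 0 < ε) :
    ∃ δ > 0, ∀ z z' : InfluenceArgs T, ‖z‖ ≤ R → ‖z' - z‖ < δ →
      |influenceAt z' - influenceAt z| ≤ ε := by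
  have hu := (isCompact_closedBall (0 : InfluenceArgs T) (R + 1)).uniformContinuousOn_of_continuous
    continuous_influenceAt.continuousOn
  obtain ⟨δ, hδ, h⟩ := Metric.uniformContinuousOn_iff.1 hu ε hε
  -- The cap at `1` keeps `z'` inside the ball of radius `R + 1`.
  refine ⟨min δ 1, lt_min hδ one_pos, fun z z' hz hzz' => ?_⟩
  have hz' : ‖z'‖ ≤ R + 1 := by
    have h1 := norm_add_le z (z' - z)
    rw [add_sub_cancel] at h1
    linarith [hzz'.trans_le (min_le_right δ 1)]
  have := h z' (mem_closedBall_zero_iff.2 hz') z (mem_closedBall_zero_iff.2 (by linarith))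
    (by rw [dist_eq_norm]; exact hzz'.trans_le (min_le_left _ _))
  rw [Real.dist_eq] at this
  exact this.le

/-- `D` is continuous in the `Γ`s, so near their means it stays above half its limit, bounded away
from zero. -/
theorem exists_half_lt_sub_dotProduct {g d : ℝ} {v : Fin T → ℝ} (hd : d = g - v ⬝ᵥ v) (hd0 : 0 < d) :
    ∃ δ > 0, ∀ (gθ gww : ℝ) (gw : Fin T → ℝ), |gθ - 1| < δ → |gww - g| < δ →
      (∀ t, |gw t - v t| < δ) → d / 2 < gww * gθ - gw ⬝ᵥ gw := by
  have hc : Continuous fun z : ℝ × ℝ × (Fin T → ℝ) => z.2.1 * z.1 - z.2.2 ⬝ᵥ z.2.2 := by fun_prop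
  have hlim := (hc.tendsto (1, g, v)).eventually_const_lt
    (u := d / 2) (by simp only [mul_one, ← hd]; linarith)
  obtain ⟨δ, hδ, h⟩ := Metric.eventually_nhds_iff.1 hlim
  refine ⟨δ, hδ, fun gθ gww gw h1 h2 h3 => h (y := (gθ, gww, gw)) ?_⟩
  rw [Prod.dist_eq, Prod.dist_eq, max_lt_iff, max_lt_iff]
  exact ⟨h1, h2, (dist_pi_lt_iff hδ).2 h3⟩

end Influence

section Bounds

variable {n T : ℕ}

theorem abs_J_mulVec_le {v : Fin T → ℝ} {K : ℝ} (h : ∀ t, |v t| ≤ K) (t : Fin T) :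
    |(J T *ᵥ v) t| ≤ 2 * K := by
  rw [J_mulVec_apply]
  have h1 := inv_mul_sum_abs_le ((abs_nonneg _).trans (h t)) h
  exact (abs_sub _ _).trans (by linarith [h t])

theorem abs_dotProduct_le {u v : Fin T → ℝ} {A K : ℝ} (hA : 0 ≤ A) (hu : ∀ t, |u t| ≤ A)
    (hv : ∀ t, |v t| ≤ K) : |u ⬝ᵥ v| ≤ T * (A * K) := by
  refine (Finset.abs_sum_le_sum_abs _ _).trans ?_
  have : ∀ t ∈ Finset.univ, |u t * v t| ≤ A * K := fun t _ => by
    rw [abs_mul]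
    exact mul_le_mul (hu t) (hv t) (abs_nonneg _) hA
  refine (Finset.sum_le_sum this).trans ?_
  simp

theorem abs_vec_le (w : Path T) (t : Fin T) : |vec w t| ≤ 1 := by
  cases h : w t <;> simp [vec, h]

theorem abs_obs_le {y : Fin T → Bool → ℝ} {M : ℝ} (hy : ∀ t b, |y t b| ≤ M) (w : Path T)
    (t : Fin T) : |obs y w t| ≤ M := by
  cases h : w t <;> simp [obs, vec, h, hy]

theorem abs_date_le {ξ : Fin T → ℝ} (hξ : ∀ t, 0 ≤ ξ t) (hsum : ∑ t, ξ t = 1)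
    {Y : Fin n → Fin T → Bool → ℝ} {M : ℝ} (hM : 0 ≤ M) (hY : ∀ i t b, |Y i t b| ≤ M) :
    |date ξ Y| ≤ 2 * M := by
  refine (Finset.abs_sum_le_sum_abs _ _).trans ?_
  have : ∀ t ∈ Finset.univ, |ξ t * ((n : ℝ)⁻¹ * ∑ i, (Y i t true - Y i t false))| ≤
      ξ t * (2 * M) := fun t _ => by
    rw [abs_mul, abs_of_nonneg (hξ t)]
    refine mul_le_mul_of_nonneg_left (inv_mul_sum_abs_le (by positivity) fun i => ?_) (hξ t)
    exact (abs_sub _ _).trans (by linarith [hY i t true, hY i t false])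
  refine (Finset.sum_le_sum this).trans ?_
  rw [← Finset.sum_mul, hsum, one_mul]

end Bounds

/-! ### The `Γ`s as path averages and the linear form of the influence terms. -/

section Averages

variable {Ω : Type*} [MeasurableSpace Ω] {n T : ℕ} (p : Path T → ℝ) (P : Measure Ω)
  (W : Fin n → Ω → Path T) (Y : Fin n → Fin T → Bool → ℝ)

/-- The reshaped weight of unit `i` on the path `w`. -/
noncomputable def pathWeight (i : Fin n) (w : Path T) : ℝ := p w / propensity P (W i) w

theorem abs_pathWeight_le {S : Set (Path T)} {c : ℝ} (hp : IsReshapedDistribution p S) (hc : 0 < c)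
    (hπ : ∀ i, ∀ w ∈ S, c < propensity P (W i) w) (i : Fin n) (w : Path T) :
    |pathWeight p P W i w| ≤ c⁻¹ := by
  have h1 : p w ≤ 1 := by
    rw [← hp.sum_eq_one]
    exact Finset.single_le_sum (fun w _ => hp.nonneg w) (Finset.mem_univ w)
  by_cases hw : p w = 0
  · simp [pathWeight, hw, hc.le]
  · have hwS : w ∈ S := by
      rw [← hp.support_eq]
      exact hw
    have h2 := hπ i w hwS
    rw [pathWeight, abs_of_nonneg (div_nonneg (hp.nonneg w) (hc.trans h2).le), ← one_div]
    exact div_le_div₀ zero_le_one h1 hc h2.le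

theorem abs_pathWeight_mul_le {S : Set (Path T)} {c : ℝ} (hp : IsReshapedDistribution p S)
    (hc : 0 < c) (hπ : ∀ i, ∀ w ∈ S, c < propensity P (W i) w) {g : Fin n → Path T → ℝ} {K : ℝ}
    (hg : ∀ i w, |g i w| ≤ K) (i : Fin n) (w : Path T) :
    |pathWeight p P W i w * g i w| ≤ c⁻¹ * K := by
  rw [abs_mul]
  exact mul_le_mul (abs_pathWeight_le p P W hp hc hπ i w) (hg i w) (abs_nonneg _) (by positivity)

theorem GammaTheta_eq : GammaTheta p P W = pathAvg W (pathWeight p P W) := rfl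

theorem GammaWW_eq : GammaWW p P W =
    pathAvg W fun i w => pathWeight p P W i w * (vec w ⬝ᵥ (J T *ᵥ vec w)) := rfl

theorem GammaWY_eq : GammaWY p P W Y =
    pathAvg W fun i w => pathWeight p P W i w * (vec w ⬝ᵥ (J T *ᵥ obs (Y i) w)) := rfl

theorem GammaW_eq (t : Fin T) : (fun ω => GammaW p P W ω t) =
    pathAvg W fun i w => pathWeight p P W i w * (J T *ᵥ vec w) t := by
  ext ω
  simp [GammaW, pathAvg, pathWeight, Theta]

theorem GammaY_eq (t : Fin T) : (fun ω => GammaY p P W Y ω t) =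
    pathAvg W fun i w => pathWeight p P W i w * (J T *ᵥ obs (Y i) w) t := by
  ext ω
  simp [GammaY, pathAvg, pathWeight, Theta]

/-- `V_i` as a function of the path of unit `i`. -/
noncomputable def pathInfluence (ξ : Fin T → ℝ) (i : Fin n) (w : Path T) : ℝ :=
  influence (date ξ Y) (∫ ω', GammaTheta p P W ω' ∂P) (∫ ω', GammaWW p P W ω' ∂P)
    (∫ ω', GammaWY p P W Y ω' ∂P) (fun t => ∫ ω', GammaW p P W ω' t ∂P)
    (fun t => ∫ ω', GammaY p P W Y ω' t ∂P) (pathWeight p P W i w) (vec w) (obs (Y i) w)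

/-- The average of influence terms is a linear function of the `Γ`s. -/
theorem inv_mul_sum_influence (hT : T ≠ 0) (τ gθ gww gwy : ℝ) (gw gy : Fin T → ℝ)
    (hgw : J T *ᵥ gw = gw) (hgy : J T *ᵥ gy = gy) (ω : Ω) :
    (n : ℝ)⁻¹ * ∑ i, influence τ gθ gww gwy gw gy (Theta p P W i ω) (vec (W i ω))
      (obs (Y i) (W i ω)) =
    GammaTheta p P W ω * (gwy - τ * gww) + gθ * (GammaWY p P W Y ω - τ * GammaWW p P W ω) -
      (gy - τ • gw) ⬝ᵥ GammaW p P W ω - gw ⬝ᵥ (GammaY p P W Y ω - τ • GammaW p P W ω) := by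
  -- Pairing with a centred vector sees only the centred part, so raw paths and outcomes may be
  -- replaced by the centred ones that make up `Γ_w` and `Γ_y`.
  have hJ : ∀ u v : Fin T → ℝ, J T *ᵥ u = u → u ⬝ᵥ v = u ⬝ᵥ (J T *ᵥ v) := fun u v hu => by
    rw [← J_mulVec_dotProduct hT, hu]
  have hunit : ∀ i, influence τ gθ gww gwy gw gy (Theta p P W i ω) (vec (W i ω))
      (obs (Y i) (W i ω)) =
      Theta p P W i ω * (gwy - τ * gww) +
      gθ * (Theta p P W i ω * (vec (W i ω) ⬝ᵥ (J T *ᵥ obs (Y i) (W i ω))) -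
        τ * (Theta p P W i ω * (vec (W i ω) ⬝ᵥ (J T *ᵥ vec (W i ω))))) -
      (gy - τ • gw) ⬝ᵥ (Theta p P W i ω • (J T *ᵥ vec (W i ω))) -
      gw ⬝ᵥ (Theta p P W i ω • (J T *ᵥ obs (Y i) (W i ω)) -
        τ • Theta p P W i ω • (J T *ᵥ vec (W i ω))) := by
    intro i
    rw [influence, hJ (gy - τ • gw) _ (by rw [Matrix.mulVec_sub, Matrix.mulVec_smul, hgw, hgy]),
      hJ gw _ hgw]
    simp only [Matrix.mulVec_sub, Matrix.mulVec_smul, dotProduct_sub, dotProduct_smul, smul_eq_mul]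
    ring
  simp only [hunit, Finset.sum_add_distrib, Finset.sum_sub_distrib, ← Finset.sum_mul,
    ← Finset.mul_sum, ← dotProduct_sum, ← Finset.smul_sum]
  simp only [GammaTheta, GammaWW, GammaWY, GammaW, GammaY, dotProduct_sub, dotProduct_smul,
    smul_eq_mul]
  ring

/-- The estimating function is affine in `τ` with slope `-DD` and root `τhat`. -/
theorem normal_eq_eq_mul_DD {τ τhat : ℝ} {ω : Ω}
    (hτ : τhat * DD p P W ω = GammaWY p P W Y ω * GammaTheta p P W ω -
      GammaW p P W ω ⬝ᵥ GammaY p P W Y ω) :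
    (GammaWY p P W Y ω - τ * GammaWW p P W ω) * GammaTheta p P W ω -
      GammaW p P W ω ⬝ᵥ (GammaY p P W Y ω - τ • GammaW p P W ω) =
      (τhat - τ) * DD p P W ω := by
  rw [sub_mul τhat, hτ, DD, dotProduct_sub, dotProduct_smul, smul_eq_mul]
  ring

/-- The Wald interval covers as soon as the estimating function at `τ*(ξ)` is small. -/
theorem date_mem_waldInterval {ξ : Fin T → ℝ} {a τhat : ℝ} {ω : Ω} (hn : 0 < n)
    (hD : 0 < DD p P W ω)
    (h : √(n : ℝ) * |(τhat - date ξ Y) * DD p P W ω| ≤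
      normalQuantile (1 - a / 2) * √(sigmaHatSq p P W Y τhat ω)) :
    date ξ Y ∈ waldInterval p P W Y a τhat ω := by
  have hsn : 0 < √(n : ℝ) := Real.sqrt_pos.2 (Nat.cast_pos.2 hn)
  rw [abs_mul, abs_of_pos hD] at h
  have h' : |τhat - date ξ Y| ≤
      normalQuantile (1 - a / 2) * √(sigmaHatSq p P W Y τhat ω) / (√(n : ℝ) * DD p P W ω) := by
    rw [le_div_iff₀ (by positivity)]
    linarith
  rw [abs_le] at h'
  rw [waldInterval, Set.mem_Icc]
  constructor <;> linarith

end Averages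

/-! ### Means of the `Γ`s and expansion of the estimating function. -/

section DotProduct

variable {Ω : Type*} [MeasurableSpace Ω] {T : ℕ} {P : Measure Ω}

theorem integral_dotProduct {G : Ω → Fin T → ℝ} (hG : ∀ t, Integrable (fun ω => G ω t) P)
    (u : Fin T → ℝ) : ∫ ω, u ⬝ᵥ G ω ∂P = u ⬝ᵥ fun t => ∫ ω, G ω t ∂P := by
  simp only [dotProduct]
  rw [integral_finsetSum _ fun t _ => (hG t).const_mul _]
  simp only [integral_const_mul]

theorem integrable_dotProduct {G : Ω → Fin T → ℝ} (hG : ∀ t, Integrable (fun ω => G ω t) P)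
    (u : Fin T → ℝ) : Integrable (fun ω => u ⬝ᵥ G ω) P :=
  integrable_finsetSum _ fun t _ => (hG t).const_mul _

end DotProduct

section Means

variable {Ω : Type*} [MeasurableSpace Ω] {n T : ℕ} {p : Path T → ℝ} {P : Measure Ω}
  [IsProbabilityMeasure P] {W : Fin n → Ω → Path T}

theorem integral_pathAvg_reshaped (hW : ∀ i, Measurable (W i))
    (hπ : ∀ i w, p w ≠ 0 → propensity P (W i) w ≠ 0) (g : Fin n → Path T → ℝ) :
    ∫ ω, pathAvg W (fun i w => pathWeight p P W i w * g i w) ω ∂P =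
      (n : ℝ)⁻¹ * ∑ i, ∑ w, p w * g i w := by
  rw [integral_pathAvg hW]
  congr 1
  exact Finset.sum_congr rfl fun i _ => integral_reshaped (hW i) (hπ i) (g i)

theorem integral_GammaTheta (hW : ∀ i, Measurable (W i))
    (hπ : ∀ i w, p w ≠ 0 → propensity P (W i) w ≠ 0) (hp : ∑ w, p w = 1) (hn : n ≠ 0) :
    ∫ ω, GammaTheta p P W ω ∂P = 1 := by
  have h := integral_pathAvg_reshaped hW hπ fun _ _ => 1
  simp only [mul_one, hp, Finset.sum_const, Finset.card_univ, Fintype.card_fin, nsmul_eq_mul] at h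
  rw [GammaTheta_eq]
  refine h.trans (inv_mul_cancel₀ (Nat.cast_ne_zero.2 hn))

theorem integral_GammaWW (hW : ∀ i, Measurable (W i))
    (hπ : ∀ i w, p w ≠ 0 → propensity P (W i) w ≠ 0) (hn : n ≠ 0) :
    ∫ ω, GammaWW p P W ω ∂P = ∑ w, p w * (vec w ⬝ᵥ (J T *ᵥ vec w)) := by
  have hn' : (n : ℝ) ≠ 0 := Nat.cast_ne_zero.2 hn
  rw [GammaWW_eq, integral_pathAvg_reshaped hW hπ fun _ w => vec w ⬝ᵥ (J T *ᵥ vec w)]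
  simp only [Finset.sum_const, Finset.card_univ, Fintype.card_fin, nsmul_eq_mul]
  field_simp

theorem integral_GammaW (hW : ∀ i, Measurable (W i))
    (hπ : ∀ i w, p w ≠ 0 → propensity P (W i) w ≠ 0) (hn : n ≠ 0) :
    (fun t => ∫ ω, GammaW p P W ω t ∂P) = J T *ᵥ meanPath p := by
  have hn' : (n : ℝ) ≠ 0 := Nat.cast_ne_zero.2 hn
  ext t
  rw [GammaW_eq, integral_pathAvg_reshaped hW hπ fun _ w => (J T *ᵥ vec w) t, J_mulVec_meanPath]
  simp only [Finset.sum_const, Finset.card_univ, Fintype.card_fin, nsmul_eq_mul, Finset.sum_apply,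
    Pi.smul_apply, smul_eq_mul]
  field_simp

theorem integral_GammaWY (hW : ∀ i, Measurable (W i))
    (hπ : ∀ i w, p w ≠ 0 → propensity P (W i) w ≠ 0) (Y : Fin n → Fin T → Bool → ℝ) :
    ∫ ω, GammaWY p P W Y ω ∂P =
      (n : ℝ)⁻¹ * ∑ i, ∑ w, p w * (vec w ⬝ᵥ (J T *ᵥ obs (Y i) w)) := by
  rw [GammaWY_eq, integral_pathAvg_reshaped hW hπ fun i w => vec w ⬝ᵥ (J T *ᵥ obs (Y i) w)]

theorem integral_GammaY (hW : ∀ i, Measurable (W i))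
    (hπ : ∀ i w, p w ≠ 0 → propensity P (W i) w ≠ 0) (Y : Fin n → Fin T → Bool → ℝ) :
    (fun t => ∫ ω, GammaY p P W Y ω t ∂P) =
      fun t => (n : ℝ)⁻¹ * ∑ i, ∑ w, p w * (J T *ᵥ obs (Y i) w) t := by
  ext t
  rw [GammaY_eq, integral_pathAvg_reshaped hW hπ fun i w => (J T *ᵥ obs (Y i) w) t]

/-- Means of centred vectors are centred, as `inv_mul_sum_influence` requires. -/
theorem J_mulVec_integral_GammaW (hT : T ≠ 0) (hW : ∀ i, Measurable (W i))
    (hπ : ∀ i w, p w ≠ 0 → propensity P (W i) w ≠ 0) (hn : n ≠ 0) :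
    J T *ᵥ (fun t => ∫ ω, GammaW p P W ω t ∂P) = fun t => ∫ ω, GammaW p P W ω t ∂P := by
  rw [integral_GammaW hW hπ hn, J_mulVec_J_mulVec hT]

theorem J_mulVec_integral_GammaY (hT : T ≠ 0) (hW : ∀ i, Measurable (W i))
    (hπ : ∀ i w, p w ≠ 0 → propensity P (W i) w ≠ 0) (Y : Fin n → Fin T → Bool → ℝ) :
    J T *ᵥ (fun t => ∫ ω, GammaY p P W Y ω t ∂P) = fun t => ∫ ω, GammaY p P W Y ω t ∂P := by
  have h : (fun t => (n : ℝ)⁻¹ * ∑ i, ∑ w, p w * (J T *ᵥ obs (Y i) w) t) =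
      J T *ᵥ ((n : ℝ)⁻¹ • ∑ i, ∑ w, p w • obs (Y i) w) := by
    ext t
    simp [Matrix.mulVec_smul, Matrix.mulVec_sum]
  rw [integral_GammaY hW hπ, h, J_mulVec_J_mulVec hT]

/-- The means of the `Γ`s are expectations under `p`, where the DATE equation applies through
`population_normal_eq`. -/
theorem integral_normal_eq (hT : T ≠ 0) (hW : ∀ i, Measurable (W i))
    (hπ : ∀ i w, p w ≠ 0 → propensity P (W i) w ≠ 0) (hp : ∑ w, p w = 1) (hn : n ≠ 0)
    {ξ : Fin T → ℝ} (hDATE : DATEEquation p ξ) (Y : Fin n → Fin T → Bool → ℝ) :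
    (∫ ω, GammaWY p P W Y ω ∂P - date ξ Y * ∫ ω, GammaWW p P W ω ∂P) -
      (fun t => ∫ ω, GammaW p P W ω t ∂P) ⬝ᵥ ((fun t => ∫ ω, GammaY p P W Y ω t ∂P) -
        date ξ Y • fun t => ∫ ω, GammaW p P W ω t ∂P) = 0 := by
  have h := hDATE.population_normal_eq hT hp Y
  rw [integral_GammaWY hW hπ, integral_GammaWW hW hπ hn, integral_GammaW hW hπ hn,
    integral_GammaY hW hπ, dotProduct_sub, dotProduct_smul, smul_eq_mul]
  rw [limitDD] at h
  linear_combination h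

/-- Evaluated at `E[Γ]`, the derivative of a quadratic form at `E[Γ]` is twice the form, which
vanishes by `integral_normal_eq`. -/
theorem integral_pathAvg_pathInfluence (hT : T ≠ 0) (hW : ∀ i, Measurable (W i))
    (hπ : ∀ i w, p w ≠ 0 → propensity P (W i) w ≠ 0) (hp : ∑ w, p w = 1) (hn : n ≠ 0)
    {ξ : Fin T → ℝ} (hDATE : DATEEquation p ξ) (Y : Fin n → Fin T → Bool → ℝ) :
    ∫ ω, pathAvg W (pathInfluence p P W Y ξ) ω ∂P = 0 := by
  have hθ : Integrable (GammaTheta p P W) P := by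
    rw [GammaTheta_eq]
    exact integrable_pathAvg hW _
  have hww : Integrable (GammaWW p P W) P := by
    rw [GammaWW_eq]
    exact integrable_pathAvg hW _
  have hwy : Integrable (GammaWY p P W Y) P := by
    rw [GammaWY_eq]
    exact integrable_pathAvg hW _
  have hw : ∀ t, Integrable (fun ω => GammaW p P W ω t) P := fun t => by
    rw [GammaW_eq]
    exact integrable_pathAvg hW _
  have hy : ∀ t, Integrable (fun ω => GammaY p P W Y ω t) P := fun t => by
    rw [GammaY_eq]
    exact integrable_pathAvg hW _
  have hyw : ∀ t, Integrable (fun ω => (GammaY p P W Y ω - date ξ Y • GammaW p P W ω) t) P :=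
    fun t => (hy t).sub ((hw t).const_mul _)
  have hlin := fun ω => inv_mul_sum_influence p P W Y hT (date ξ Y) (∫ ω', GammaTheta p P W ω' ∂P)
    (∫ ω', GammaWW p P W ω' ∂P) (∫ ω', GammaWY p P W Y ω' ∂P)
    (fun t => ∫ ω', GammaW p P W ω' t ∂P) (fun t => ∫ ω', GammaY p P W Y ω' t ∂P)
    (J_mulVec_integral_GammaW hT hW hπ hn) (J_mulVec_integral_GammaY hT hW hπ Y) ω
  have hfun : pathAvg W (pathInfluence p P W Y ξ) = _ := funext hlin
  have h := integral_normal_eq hT hW hπ hp hn hDATE Y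
  have hsub : (fun t => ∫ ω, (GammaY p P W Y ω - date ξ Y • GammaW p P W ω) t ∂P) =
      (fun t => ∫ ω, GammaY p P W Y ω t ∂P) - date ξ Y • fun t => ∫ ω, GammaW p P W ω t ∂P := by
    ext t
    simp only [Pi.sub_apply, Pi.smul_apply, smul_eq_mul]
    rw [integral_sub (hy t) ((hw t).const_mul _), integral_const_mul]
  have hb : Integrable (fun ω => GammaWY p P W Y ω - date ξ Y * GammaWW p P W ω) P :=
    hwy.sub (hww.const_mul _)
  have hlinear : ∀ (k m : ℝ) (u v : Fin T → ℝ),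
      ∫ ω, (GammaTheta p P W ω * k + m * (GammaWY p P W Y ω - date ξ Y * GammaWW p P W ω) -
        u ⬝ᵥ GammaW p P W ω - v ⬝ᵥ (GammaY p P W Y ω - date ξ Y • GammaW p P W ω)) ∂P =
      k + m * (∫ ω, GammaWY p P W Y ω ∂P - date ξ Y * ∫ ω, GammaWW p P W ω ∂P) -
        u ⬝ᵥ (fun t => ∫ ω, GammaW p P W ω t ∂P) -
        v ⬝ᵥ ((fun t => ∫ ω, GammaY p P W Y ω t ∂P) -
          date ξ Y • fun t => ∫ ω, GammaW p P W ω t ∂P) := by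
    intro k m u v
    have h1 : Integrable (fun ω => GammaTheta p P W ω * k +
        m * (GammaWY p P W Y ω - date ξ Y * GammaWW p P W ω)) P :=
      (hθ.mul_const _).add (hb.const_mul _)
    have h2 : Integrable (fun ω => GammaTheta p P W ω * k +
        m * (GammaWY p P W Y ω - date ξ Y * GammaWW p P W ω) - u ⬝ᵥ GammaW p P W ω) P :=
      h1.sub (integrable_dotProduct hw u)
    rw [integral_sub h2 (integrable_dotProduct hyw v), integral_sub h1 (integrable_dotProduct hw u),
      integral_add (hθ.mul_const _) (hb.const_mul _), integral_mul_const, integral_const_mul,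
      integral_sub hwy (hww.const_mul _), integral_const_mul, integral_dotProduct hw,
      integral_dotProduct hyw, integral_GammaTheta hW hπ hp hn, hsub, one_mul]
  rw [hfun, hlinear, dotProduct_comm ((fun t => ∫ ω, GammaY p P W Y ω t ∂P) - _),
    integral_GammaTheta hW hπ hp hn]
  linear_combination 2 * h

/-- The estimating function at `τ*(ξ)` differs from the average of the `V_i` by a product of
deviations. -/
theorem normal_eq_sub_pathAvg (hT : T ≠ 0) (hW : ∀ i, Measurable (W i))
    (hπ : ∀ i w, p w ≠ 0 → propensity P (W i) w ≠ 0) (hp : ∑ w, p w = 1) (hn : n ≠ 0)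
    {ξ : Fin T → ℝ} (hDATE : DATEEquation p ξ) (Y : Fin n → Fin T → Bool → ℝ) (ω : Ω) :
    (GammaWY p P W Y ω - date ξ Y * GammaWW p P W ω) * GammaTheta p P W ω -
      GammaW p P W ω ⬝ᵥ (GammaY p P W Y ω - date ξ Y • GammaW p P W ω) -
      pathAvg W (pathInfluence p P W Y ξ) ω =
    ((GammaWY p P W Y ω - ∫ ω', GammaWY p P W Y ω' ∂P) -
      date ξ Y * (GammaWW p P W ω - ∫ ω', GammaWW p P W ω' ∂P)) * (GammaTheta p P W ω - 1) -
      (GammaW p P W ω - fun t => ∫ ω', GammaW p P W ω' t ∂P) ⬝ᵥ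
        ((GammaY p P W Y ω - fun t => ∫ ω', GammaY p P W Y ω' t ∂P) -
          date ξ Y • (GammaW p P W ω - fun t => ∫ ω', GammaW p P W ω' t ∂P)) := by
  have hlin := inv_mul_sum_influence p P W Y hT (date ξ Y) (∫ ω', GammaTheta p P W ω' ∂P)
    (∫ ω', GammaWW p P W ω' ∂P) (∫ ω', GammaWY p P W Y ω' ∂P)
    (fun t => ∫ ω', GammaW p P W ω' t ∂P) (fun t => ∫ ω', GammaY p P W Y ω' t ∂P)
    (J_mulVec_integral_GammaW hT hW hπ hn) (J_mulVec_integral_GammaY hT hW hπ Y) ω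
  have hlin' : pathAvg W (pathInfluence p P W Y ξ) ω = _ := hlin
  have h := integral_normal_eq hT hW hπ hp hn hDATE Y
  rw [hlin', integral_GammaTheta hW hπ hp hn]
  generalize (fun t => ∫ ω', GammaW p P W ω' t ∂P) = mw at *
  generalize (fun t => ∫ ω', GammaY p P W Y ω' t ∂P) = my at *
  simp only [dotProduct_sub, sub_dotProduct, dotProduct_smul, smul_dotProduct, smul_eq_mul] at h ⊢
  rw [dotProduct_comm my (GammaW p P W ω), dotProduct_comm (GammaW p P W ω) mw]
  -- For a quadratic form `N`, means `m` and deviations `d`, subtracting the derivative at `m` in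
  -- direction `m + d` from `N(m + d)` leaves `N(d) - N(m)`; here `N(m) = 0` is `h`.
  linear_combination -h

end Means

/-! ### Deterministic coverage when all deviations are small. -/

section Deviations

variable {Ω : Type*} [MeasurableSpace Ω] {n T : ℕ}

/-- All the averages that enter the confidence interval are within `κ` of their means. -/
structure DeviationsLT (p : Path T → ℝ) (P : Measure Ω) (W : Fin n → Ω → Path T)
    (Y : Fin n → Fin T → Bool → ℝ) (ξ : Fin T → ℝ) (κ : ℝ) (ω : Ω) : Prop where
  theta : |GammaTheta p P W ω - ∫ ω', GammaTheta p P W ω' ∂P| < κ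
  ww : |GammaWW p P W ω - ∫ ω', GammaWW p P W ω' ∂P| < κ
  wy : |GammaWY p P W Y ω - ∫ ω', GammaWY p P W Y ω' ∂P| < κ
  w : ∀ t, |GammaW p P W ω t - ∫ ω', GammaW p P W ω' t ∂P| < κ
  y : ∀ t, |GammaY p P W Y ω t - ∫ ω', GammaY p P W Y ω' t ∂P| < κ
  infl : |pathAvg W (pathInfluence p P W Y ξ) ω -
    ∫ ω', pathAvg W (pathInfluence p P W Y ξ) ω' ∂P| < κ
  inflSq : |pathAvg W (fun i w => pathInfluence p P W Y ξ i w ^ 2) ω -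
    ∫ ω', pathAvg W (fun i w => pathInfluence p P W Y ξ i w ^ 2) ω' ∂P| < κ

/-- A bound for all the arguments of the influence terms. -/
noncomputable def radius (T : ℕ) (c M : ℝ) : ℝ :=
  1 + 3 * M + c⁻¹ + c⁻¹ * (T * (1 * (2 * 1))) + c⁻¹ * (T * (1 * (2 * M))) + c⁻¹ * (2 * 1) +
    c⁻¹ * (2 * M)

variable {p : Path T → ℝ} {P : Measure Ω} {W : Fin n → Ω → Path T}
  {Y : Fin n → Fin T → Bool → ℝ} {S : Set (Path T)} {c M : ℝ}

theorem abs_theta_le_radius (hp : IsReshapedDistribution p S) (hc : 0 < c) (hM : 0 ≤ M)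
    (hπ : ∀ i, ∀ w ∈ S, c < propensity P (W i) w) (i : Fin n) (w : Path T) :
    |pathWeight p P W i w| ≤ radius T c M := by
  refine (abs_pathWeight_le p P W hp hc hπ i w).trans ?_
  rw [radius]
  have h1 : 0 ≤ 1 + 3 * M + c⁻¹ * (T * (1 * (2 * 1))) + c⁻¹ * (T * (1 * (2 * M))) +
    c⁻¹ * (2 * 1) + c⁻¹ * (2 * M) := by positivity
  linarith

theorem abs_ww_le_radius (hp : IsReshapedDistribution p S) (hc : 0 < c) (hM : 0 ≤ M)
    (hπ : ∀ i, ∀ w ∈ S, c < propensity P (W i) w) (i : Fin n) (w : Path T) :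
    |pathWeight p P W i w * (vec w ⬝ᵥ (J T *ᵥ vec w))| ≤ radius T c M := by
  refine (abs_pathWeight_mul_le p P W hp hc hπ (g := fun _ w => vec w ⬝ᵥ (J T *ᵥ vec w))
    (fun _ w => abs_dotProduct_le zero_le_one (abs_vec_le w)
      (abs_J_mulVec_le (abs_vec_le w))) i w).trans ?_
  rw [radius]
  have h1 : 0 ≤ 1 + 3 * M + c⁻¹ + c⁻¹ * (T * (1 * (2 * M))) +
    c⁻¹ * (2 * 1) + c⁻¹ * (2 * M) := by positivity
  linarith

theorem abs_wy_le_radius (hp : IsReshapedDistribution p S) (hc : 0 < c) (hM : 0 ≤ M)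
    (hπ : ∀ i, ∀ w ∈ S, c < propensity P (W i) w) (hY : ∀ i t b, |Y i t b| ≤ M) (i : Fin n)
    (w : Path T) :
    |pathWeight p P W i w * (vec w ⬝ᵥ (J T *ᵥ obs (Y i) w))| ≤ radius T c M := by
  refine (abs_pathWeight_mul_le p P W hp hc hπ (g := fun i w => vec w ⬝ᵥ (J T *ᵥ obs (Y i) w))
    (fun i w => abs_dotProduct_le zero_le_one (abs_vec_le w)
      (abs_J_mulVec_le (abs_obs_le (hY i) w))) i w).trans ?_
  rw [radius]
  have h1 : 0 ≤ 1 + 3 * M + c⁻¹ + c⁻¹ * (T * (1 * (2 * 1))) +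
    c⁻¹ * (2 * 1) + c⁻¹ * (2 * M) := by positivity
  linarith

theorem abs_w_le_radius (hp : IsReshapedDistribution p S) (hc : 0 < c) (hM : 0 ≤ M)
    (hπ : ∀ i, ∀ w ∈ S, c < propensity P (W i) w) (t : Fin T) (i : Fin n) (w : Path T) :
    |pathWeight p P W i w * (J T *ᵥ vec w) t| ≤ radius T c M := by
  refine (abs_pathWeight_mul_le p P W hp hc hπ (g := fun _ w => (J T *ᵥ vec w) t)
    (fun _ w => abs_J_mulVec_le (abs_vec_le w) t) i w).trans ?_
  rw [radius]
  have h1 : 0 ≤ 1 + 3 * M + c⁻¹ + c⁻¹ * (T * (1 * (2 * 1))) + c⁻¹ * (T * (1 * (2 * M))) +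
    c⁻¹ * (2 * M) := by positivity
  linarith

theorem abs_y_le_radius (hp : IsReshapedDistribution p S) (hc : 0 < c) (hM : 0 ≤ M)
    (hπ : ∀ i, ∀ w ∈ S, c < propensity P (W i) w) (hY : ∀ i t b, |Y i t b| ≤ M) (t : Fin T)
    (i : Fin n) (w : Path T) :
    |pathWeight p P W i w * (J T *ᵥ obs (Y i) w) t| ≤ radius T c M := by
  refine (abs_pathWeight_mul_le p P W hp hc hπ (g := fun i w => (J T *ᵥ obs (Y i) w) t)
    (fun i w => abs_J_mulVec_le (abs_obs_le (hY i) w) t) i w).trans ?_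
  rw [radius]
  have h1 : 0 ≤ 1 + 3 * M + c⁻¹ + c⁻¹ * (T * (1 * (2 * 1))) + c⁻¹ * (T * (1 * (2 * M))) +
    c⁻¹ * (2 * 1) := by positivity
  linarith

/-- These summands cover path entries (at most `1`), observed outcomes (at most `M`) and the effect
(at most `2 * M`). -/
theorem one_add_three_mul_le_radius (T : ℕ) (hc : 0 < c) (hM : 0 ≤ M) :
    1 + 3 * M ≤ radius T c M := by
  rw [radius]
  have h1 : 0 ≤ c⁻¹ + c⁻¹ * (T * (1 * (2 * 1))) + c⁻¹ * (T * (1 * (2 * M))) +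
    c⁻¹ * (2 * 1) + c⁻¹ * (2 * M) := by positivity
  linarith

/-- The population arguments of `V_i`. -/
noncomputable def populationArgs (p : Path T → ℝ) (P : Measure Ω) (W : Fin n → Ω → Path T)
    (Y : Fin n → Fin T → Bool → ℝ) (ξ : Fin T → ℝ) (i : Fin n) (w : Path T) : InfluenceArgs T :=
  ((date ξ Y, ∫ ω', GammaTheta p P W ω' ∂P, ∫ ω', GammaWW p P W ω' ∂P,
    ∫ ω', GammaWY p P W Y ω' ∂P),
    (fun t => ∫ ω', GammaW p P W ω' t ∂P, fun t => ∫ ω', GammaY p P W Y ω' t ∂P),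
    (pathWeight p P W i w, vec w, obs (Y i) w))

/-- The sample arguments of the plug-in version of `V_i`. -/
noncomputable def sampleArgs (p : Path T → ℝ) (P : Measure Ω) (W : Fin n → Ω → Path T)
    (Y : Fin n → Fin T → Bool → ℝ) (τ : ℝ) (ω : Ω) (i : Fin n) : InfluenceArgs T :=
  ((τ, GammaTheta p P W ω, GammaWW p P W ω, GammaWY p P W Y ω),
    (GammaW p P W ω, GammaY p P W Y ω), (Theta p P W i ω, vec (W i ω), obs (Y i) (W i ω)))

theorem norm_populationArgs_le [IsProbabilityMeasure P] (hp : IsReshapedDistribution p S)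
    (hc : 0 < c) (hM : 0 ≤ M) (hπ : ∀ i, ∀ w ∈ S, c < propensity P (W i) w)
    (hY : ∀ i t b, |Y i t b| ≤ M) {ξ : Fin T → ℝ} (hξ : ∀ t, 0 ≤ ξ t) (hsum : ∑ t, ξ t = 1)
    (i : Fin n) (w : Path T) : ‖populationArgs p P W Y ξ i w‖ ≤ radius T c M := by
  have hR := one_add_three_mul_le_radius T hc hM
  have hR0 : 0 ≤ radius T c M := by linarith
  simp only [populationArgs, norm_prod_le_iff, pi_norm_le_iff_of_nonneg hR0, Real.norm_eq_abs]
  refine ⟨⟨?_, ?_, ?_, ?_⟩, ⟨fun t => ?_, fun t => ?_⟩, ?_, fun t => ?_, fun t => ?_⟩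
  · linarith [abs_date_le hξ hsum hM hY]
  · exact abs_integral_pathAvg_le W hR0 (abs_theta_le_radius hp hc hM hπ)
  · exact abs_integral_pathAvg_le W hR0 (abs_ww_le_radius hp hc hM hπ)
  · exact abs_integral_pathAvg_le W hR0 (abs_wy_le_radius hp hc hM hπ hY)
  · rw [GammaW_eq]
    exact abs_integral_pathAvg_le W hR0 (abs_w_le_radius hp hc hM hπ t)
  · rw [GammaY_eq]
    exact abs_integral_pathAvg_le W hR0 (abs_y_le_radius hp hc hM hπ hY t)
  · exact abs_theta_le_radius hp hc hM hπ i w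
  · linarith [abs_vec_le w t]
  · linarith [abs_obs_le (hY i) w t]

theorem norm_sampleArgs_sub_lt {ξ : Fin T → ℝ} {κ δ τ : ℝ} {ω : Ω}
    (h : DeviationsLT p P W Y ξ κ ω) (hκ : κ ≤ δ) (hτ : |τ - date ξ Y| < δ) (i : Fin n) :
    ‖sampleArgs p P W Y τ ω i - populationArgs p P W Y ξ i (W i ω)‖ < δ := by
  have hδ : 0 < δ := (abs_nonneg _).trans_lt hτ
  have hθ : Theta p P W i ω - pathWeight p P W i (W i ω) = 0 := sub_self _
  simp only [sampleArgs, populationArgs, Prod.mk_sub_mk, hθ, sub_self, Prod.norm_def, max_lt_iff,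
    norm_zero, hδ, and_true, pi_norm_lt_iff hδ, Real.norm_eq_abs, Pi.sub_apply]
  exact ⟨⟨hτ, h.theta.trans_le hκ, h.ww.trans_le hκ, h.wy.trans_le hκ⟩,
    fun t => (h.w t).trans_le hκ, fun t => (h.y t).trans_le hκ⟩

/-- The source of conservativeness: the sample variance tracks second moments, which exceed
variances by the squared individual means. -/
theorem inv_mul_sum_variance_le [IsProbabilityMeasure P] (hW : ∀ i, Measurable (W i))
    (f : Fin n → Path T → ℝ) :
    (n : ℝ)⁻¹ * ∑ i, variance (fun ω => f i (W i ω)) P ≤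
      ∫ ω, pathAvg W (fun i w => f i w ^ 2) ω ∂P := by
  rw [integral_pathAvg hW]
  gcongr with i
  exact variance_le_expectation_sq
    ((measurable_of_finite (f i)).comp (hW i)).aestronglyMeasurable

/-- The deterministic core: if all deviations are small and the standardized sum of the centred
`V_i` is below `b < z`, then the Wald interval covers. -/
theorem date_mem_waldInterval_of_deviationsLT [IsProbabilityMeasure P] (hT : T ≠ 0) (hn : 1 < n)
    (hW : ∀ i, Measurable (W i)) (hp : IsReshapedDistribution p S) (hc : 0 < c) (hM : 0 ≤ M)
    (hπ : ∀ i, ∀ w ∈ S, c < propensity P (W i) w) (hY : ∀ i t b, |Y i t b| ≤ M) {ξ : Fin T → ℝ}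
    (hξ : ∀ t, 0 ≤ ξ t) (hsum : ∑ t, ξ t = 1) (hDATE : DATEEquation p ξ)
    {B ε ε₁ δ κ b a v τhat : ℝ} {ω : Ω}
    (hτhat : (∃ τ, IsRIPWEstimate p P W Y ω τ) → IsRIPWEstimate p P W Y ω τhat)
    (hdev : DeviationsLT p P W Y ξ κ ω)
    (hhalf : ∀ (gθ gww : ℝ) (gw : Fin T → ℝ), |gθ - 1| < κ →
      |gww - ∑ w, p w * (vec w ⬝ᵥ (J T *ᵥ vec w))| < κ →
      (∀ t, |gw t - (J T *ᵥ meanPath p) t| < κ) → limitDD p / 2 < gww * gθ - gw ⬝ᵥ gw)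
    (hDpos : 0 < limitDD p)
    (hB : ∀ z : InfluenceArgs T, ‖z‖ ≤ radius T c M → |influenceAt z| ≤ B)
    (hinfl : ∀ z z' : InfluenceArgs T, ‖z‖ ≤ radius T c M → ‖z' - z‖ < δ →
      |influenceAt z' - influenceAt z| ≤ ε₁)
    (hκδ : κ ≤ δ) (hτδ : (κ + (1 + 2 * M) * (1 + T) * κ ^ 2) / (limitDD p / 2) < δ)
    (hvar : v = (n : ℝ)⁻¹ * ∑ i, variance (V p ξ P W Y i) P)
    (hεv : ∀ s, v - ε ≤ s → b * √v + ε ≤ normalQuantile (1 - a / 2) * √s)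
    (hε : κ + κ ^ 2 + 8 * B * ε₁ ≤ ε) (hεn : √(n : ℝ) * ((1 + 2 * M) * (1 + T) * κ ^ 2) ≤ ε)
    (hclt : |∑ i, (V p ξ P W Y i ω - ∫ ω', V p ξ P W Y i ω' ∂P)| < b * (√n * √v)) :
    date ξ Y ∈ waldInterval p P W Y a τhat ω := by
  have hn0 : n ≠ 0 := by omega
  have hn' : (0 : ℝ) < n := Nat.cast_pos.2 (by omega)
  have hπ' : ∀ i w, p w ≠ 0 → propensity P (W i) w ≠ 0 := fun i w hw =>
    (hc.trans (hπ i w (by rw [← hp.support_eq]; exact hw))).ne'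
  have hκ : 0 < κ := (abs_nonneg _).trans_lt hdev.theta
  set C := (1 + 2 * M) * (1 + (T : ℝ)) with hC
  have hEθ := integral_GammaTheta hW hπ' hp.sum_eq_one hn0
  have hDD : limitDD p / 2 < DD p P W ω := by
    refine hhalf _ _ _ ?_ ?_ fun t => ?_
    · rw [← hEθ]
      exact hdev.theta
    · rw [← integral_GammaWW hW hπ' hn0]
      exact hdev.ww
    · rw [← integral_GammaW hW hπ' hn0]
      exact hdev.w t
  have hDD0 : 0 < DD p P W ω := by linarith
  have hθ0 : ∀ i, 0 ≤ Theta p P W i ω := fun i => div_nonneg (hp.nonneg _) measureReal_nonneg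
  obtain ⟨hex, huniq⟩ := exists_isRIPWEstimate_and_eq hT p P W Y ω hθ0 hDD0
  have hτ := huniq τhat (hτhat hex)
  have hE0 := integral_pathAvg_pathInfluence hT hW hπ' hp.sum_eq_one hn0 hDATE Y
  set vbar := pathAvg W (pathInfluence p P W Y ξ) ω with hvbar
  have hvbarκ : |vbar| < κ := by
    have := hdev.infl
    rwa [hE0, sub_zero] at this
  -- The scalar product of deviations contributes `(1 + 2 * M) * κ ^ 2`, the dot product `T` times
  -- as much; the sum is `C * κ ^ 2`.
  have hrem : |(τhat - date ξ Y) * DD p P W ω - vbar| ≤ C * κ ^ 2 := by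
    rw [← normal_eq_eq_mul_DD p P W Y hτ,
      normal_eq_sub_pathAvg hT hW hπ' hp.sum_eq_one hn0 hDATE Y ω]
    have hτM := abs_date_le hξ hsum hM hY
    have hsub : ∀ {x y : ℝ}, |x| < κ → |y| < κ → |x - date ξ Y * y| ≤ κ + 2 * M * κ :=
      fun {x y} hx hy => by
        refine (abs_sub _ _).trans (add_le_add hx.le ?_)
        rw [abs_mul]
        exact mul_le_mul hτM hy.le (abs_nonneg _) (by positivity)
    have h1 := abs_mul ((GammaWY p P W Y ω - ∫ ω', GammaWY p P W Y ω' ∂P) -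
      date ξ Y * (GammaWW p P W ω - ∫ ω', GammaWW p P W ω' ∂P)) (GammaTheta p P W ω - 1)
    have hθκ : |GammaTheta p P W ω - 1| ≤ κ := by
      rw [← hEθ]
      exact hdev.theta.le
    have h2 := mul_le_mul (hsub hdev.wy hdev.ww) hθκ (abs_nonneg _) (by positivity)
    rw [← h1] at h2
    have h3 := abs_dotProduct_le (u := GammaW p P W ω - fun t => ∫ ω', GammaW p P W ω' t ∂P)
      (v := (GammaY p P W Y ω - fun t => ∫ ω', GammaY p P W Y ω' t ∂P) -
          date ξ Y • (GammaW p P W ω - fun t => ∫ ω', GammaW p P W ω' t ∂P)) hκ.le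
      (fun t => (hdev.w t).le) (fun t => hsub (hdev.y t) (hdev.w t))
    refine (abs_sub _ _).trans ((add_le_add h2 h3).trans (le_of_eq ?_))
    rw [hC]
    ring
  have hN : |(τhat - date ξ Y) * DD p P W ω| ≤ |vbar| + C * κ ^ 2 := by
    have := abs_add_le ((τhat - date ξ Y) * DD p P W ω - vbar) vbar
    rw [sub_add_cancel] at this
    linarith
  -- Consistency of `τhat`, needed to bring the plug-in arguments close to the population ones.
  have hττ : |τhat - date ξ Y| < δ := by
    refine lt_of_le_of_lt ?_ hτδ
    rw [le_div_iff₀ (by linarith)]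
    rw [abs_mul, abs_of_pos hDD0] at hN
    have := mul_le_mul_of_nonneg_left hDD.le (abs_nonneg (τhat - date ξ Y))
    linarith
  have hpop := norm_populationArgs_le hp hc hM hπ hY hξ hsum
  have hsv := le_sample_variance (u := fun i => V p ξ P W Y i ω)
    (v := fun i => Vhat p P W Y τhat i ω) hn (fun i => hB _ (hpop i (W i ω)))
    (fun i => hinfl _ _ (hpop i (W i ω)) (norm_sampleArgs_sub_lt hdev hκδ hττ i))
  have hsq : v - κ ≤ (n : ℝ)⁻¹ * ∑ i, V p ξ P W Y i ω ^ 2 := by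
    have h1 := inv_mul_sum_variance_le (P := P) hW (pathInfluence p P W Y ξ)
    have h2 := (abs_lt.1 hdev.inflSq).1
    have h3 : pathAvg W (fun i w => pathInfluence p P W Y ξ i w ^ 2) ω =
      (n : ℝ)⁻¹ * ∑ i, V p ξ P W Y i ω ^ 2 := rfl
    have h4 : v ≤ ∫ ω, pathAvg W (fun i w => pathInfluence p P W Y ξ i w ^ 2) ω ∂P :=
      hvar.trans_le h1
    linarith
  have hvbar' : (n : ℝ)⁻¹ * ∑ i, V p ξ P W Y i ω = vbar := rfl
  have hσ : v - ε ≤ sigmaHatSq p P W Y τhat ω := by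
    have h1 : vbar ^ 2 ≤ κ ^ 2 := sq_le_sq' (abs_lt.1 hvbarκ).1.le (abs_lt.1 hvbarκ).2.le
    simp only [hvbar'] at hsv
    rw [sigmaHatSq]
    linarith
  -- The means of the individual `V_i` may be nonzero, but they sum to zero.
  have hcentre : ∑ i, (V p ξ P W Y i ω - ∫ ω', V p ξ P W Y i ω' ∂P) = n * vbar := by
    have h1 : (n : ℝ)⁻¹ * ∑ i, ∫ ω', V p ξ P W Y i ω' ∂P = 0 := by
      rw [← hE0, integral_pathAvg hW]
      rfl
    have h2 : ∑ i, ∫ ω', V p ξ P W Y i ω' ∂P = 0 :=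
      (mul_eq_zero.1 h1).resolve_left (inv_ne_zero hn'.ne')
    rw [Finset.sum_sub_distrib, h2, sub_zero, ← hvbar']
    field_simp
  have hsn : 0 < √(n : ℝ) := Real.sqrt_pos.2 hn'
  have hS : √(n : ℝ) * |vbar| ≤ b * √v := by
    rw [hcentre, abs_mul, abs_of_pos hn'] at hclt
    have h1 : (n : ℝ) = √n * √n := (Real.mul_self_sqrt hn'.le).symm
    have h2 : √(n : ℝ) * (√(n : ℝ) * |vbar|) < √(n : ℝ) * (b * √v) := by
      rw [← mul_assoc, ← h1]
      linarith
    exact (lt_of_mul_lt_mul_left h2 hsn.le).le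
  refine date_mem_waldInterval p P W Y (by omega) hDD0 ((?_ : _ ≤ b * √v + ε).trans (hεv _ hσ))
  have := mul_le_mul_of_nonneg_left hN hsn.le
  linarith

end Deviations

/-! ### The deviation rate `n ^ (-1/3)`. -/

section Rates

theorem tendsto_natCast_mul_rpow_sq :
    Tendsto (fun n : ℕ => (n : ℝ) * ((n : ℝ) ^ (-(1 / 3) : ℝ)) ^ 2) atTop atTop := by
  have h := (tendsto_rpow_atTop (y := 1 / 3) (by norm_num)).comp
    (tendsto_natCast_atTop_atTop (R := ℝ))
  refine h.congr' ?_
  filter_upwards [eventually_gt_atTop 0] with n hn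
  have hn' : (0 : ℝ) < n := Nat.cast_pos.2 hn
  rw [Function.comp_apply, ← Real.rpow_natCast, ← Real.rpow_mul hn'.le]
  nth_rw 2 [← Real.rpow_one (n : ℝ)]
  rw [← Real.rpow_add hn']
  norm_num

theorem tendsto_rpow_neg_third : Tendsto (fun n : ℕ => (n : ℝ) ^ (-(1 / 3) : ℝ)) atTop (𝓝 0) :=
  (tendsto_rpow_neg_atTop (by norm_num)).comp tendsto_natCast_atTop_atTop

theorem tendsto_sqrt_mul_rpow_sq :
    Tendsto (fun n : ℕ => √(n : ℝ) * ((n : ℝ) ^ (-(1 / 3) : ℝ)) ^ 2) atTop (𝓝 0) := by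
  have h := (tendsto_rpow_neg_atTop (y := 1 / 6) (by norm_num)).comp
    (tendsto_natCast_atTop_atTop (R := ℝ))
  refine h.congr' ?_
  filter_upwards [eventually_gt_atTop 0] with n hn
  have hn' : (0 : ℝ) < n := Nat.cast_pos.2 hn
  rw [Function.comp_apply, ← Real.rpow_natCast, ← Real.rpow_mul hn'.le, Real.sqrt_eq_rpow,
    ← Real.rpow_add hn']
  norm_num

end Rates

/-! ### Simultaneous smallness of all deviations. -/

section HighProbability

variable {Ω : ℕ → Type*} [∀ n, MeasurableSpace (Ω n)] {P : ∀ n, Measure (Ω n)}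
  [∀ n, IsProbabilityMeasure (P n)] {T : ℕ} {p : Path T → ℝ} {W : ∀ n, Fin n → Ω n → Path T}
  {Y : ∀ n, Fin n → Fin T → Bool → ℝ} {S : Set (Path T)} {c M : ℝ}

theorem abs_pathInfluence_le (hp : IsReshapedDistribution p S) (hc : 0 < c) (hM : 0 ≤ M)
    (hπ : ∀ n i, ∀ w ∈ S, c < propensity (P n) (W n i) w) (hY : ∀ n i t b, |Y n i t b| ≤ M)
    {ξ : Fin T → ℝ} (hξ : ∀ t, 0 ≤ ξ t) (hsum : ∑ t, ξ t = 1) {B : ℝ}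
    (hB : ∀ z : InfluenceArgs T, ‖z‖ ≤ radius T c M → |influenceAt z| ≤ B) (n : ℕ) (i : Fin n)
    (w : Path T) : |pathInfluence p (P n) (W n) (Y n) ξ i w| ≤ B :=
  hB _ (norm_populationArgs_le hp hc hM (hπ n) (hY n) hξ hsum i w)

theorem highProb_deviationsLT (hW : ∀ n i, Measurable (W n i))
    (hindep : ∀ n, iIndepFun (W n) (P n)) (hp : IsReshapedDistribution p S) (hc : 0 < c)
    (hM : 0 ≤ M) (hπ : ∀ n i, ∀ w ∈ S, c < propensity (P n) (W n i) w)
    (hY : ∀ n i t b, |Y n i t b| ≤ M) {ξ : Fin T → ℝ} (hξ : ∀ t, 0 ≤ ξ t) (hsum : ∑ t, ξ t = 1)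
    {κ : ℕ → ℝ} (hκ : ∀ n, 0 < n → 0 < κ n)
    (hκn : Tendsto (fun n : ℕ => n * κ n ^ 2) atTop atTop) :
    HighProb P fun n ω => DeviationsLT p (P n) (W n) (Y n) ξ (κ n) ω := by
  obtain ⟨B, hB⟩ := exists_abs_influenceAt_le T (radius T c M)
  have hV := abs_pathInfluence_le hp hc hM hπ hY hξ hsum hB
  have hV2 : ∀ n (i : Fin n) w, |pathInfluence p (P n) (W n) (Y n) ξ i w ^ 2| ≤ B ^ 2 :=
    fun n i w => by
      rw [abs_pow]
      exact pow_le_pow_left₀ (abs_nonneg _) (hV n i w) 2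
  have h1 := highProb_pathAvg_sub_lt hW hindep
    (fun n => abs_theta_le_radius hp hc hM (hπ n)) hκ hκn
  have h2 := highProb_pathAvg_sub_lt hW hindep (fun n => abs_ww_le_radius hp hc hM (hπ n)) hκ hκn
  have h3 := highProb_pathAvg_sub_lt hW hindep
    (fun n => abs_wy_le_radius hp hc hM (hπ n) (hY n)) hκ hκn
  have h4 := HighProb.forall fun t => highProb_pathAvg_sub_lt hW hindep
    (fun n => abs_w_le_radius hp hc hM (hπ n) t) hκ hκn
  have h5 := HighProb.forall fun t => highProb_pathAvg_sub_lt hW hindep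
    (fun n => abs_y_le_radius hp hc hM (hπ n) (hY n) t) hκ hκn
  have h6 := highProb_pathAvg_sub_lt hW hindep hV hκ hκn
  have h7 := highProb_pathAvg_sub_lt hW hindep hV2 hκ hκn
  refine ((h1.and h2).and ((h3.and h4).and (h5.and (h6.and h7)))).mono (.of_forall ?_)
  rintro n ω ⟨⟨g1, g2⟩, ⟨g3, g4⟩, g5, g6, g7⟩
  refine ⟨g1, g2, g3, fun t => ?_, fun t => ?_, g6, g7⟩
  · have := g4 t
    rwa [← GammaW_eq] at this
  · have := g5 t
    rwa [← GammaY_eq] at this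

end HighProbability

end RIPW

/-! ### Choice of constants and conclusion. -/

theorem mainTheorem3 {T : ℕ} (hT : 2 ≤ T)
    -- time weights and reshaped distribution
    (ξ : Fin T → ℝ) (hξ_nonneg : ∀ t, 0 ≤ ξ t) (hξ_sum : ∑ t, ξ t = 1)
    (S : Set (RIPW.Path T)) (p : RIPW.Path T → ℝ) (hp : RIPW.IsReshapedDistribution p S)
    (hDATE : RIPW.DATEEquation p ξ)
    -- for every `n`, a finite population of `n` units with random assignment paths
    {Ω : ℕ → Type*} [∀ n, MeasurableSpace (Ω n)]
    (P : ∀ n, Measure (Ω n)) [∀ n, IsProbabilityMeasure (P n)]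
    (W : ∀ n, Fin n → Ω n → RIPW.Path T) (hW : ∀ n i, Measurable (W n i))
    (Y : ∀ n, Fin n → Fin T → Bool → ℝ)
    -- independence, overlap, bounded outcomes, variance bounded below
    (hindep : ∀ n, iIndepFun (W n) (P n))
    (c : ℝ) (hc : 0 < c) (hoverlap : ∀ n, RIPW.Overlap c S (P n) (W n))
    (M : ℝ) (hM : ∀ n i t b, |Y n i t b| < M)
    (ν₀ : ℝ) (hν₀ : 0 < ν₀)
    (hvar : ∀ᶠ n : ℕ in atTop,
      ν₀ ≤ (n : ℝ)⁻¹ * ∑ i, variance (RIPW.V p ξ (P n) (W n) (Y n) i) (P n))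
    -- the estimator: a solution of the minimization problem whenever there is one
    (τhat : ∀ n, Ω n → ℝ)
    (hτhat : ∀ n ω, (∃ τ, RIPW.IsRIPWEstimate p (P n) (W n) (Y n) ω τ) →
      RIPW.IsRIPWEstimate p (P n) (W n) (Y n) ω (τhat n ω))
    (a : ℝ) (ha : a ∈ Set.Ioo (0 : ℝ) 1) :
    1 - a ≤ liminf (fun n : ℕ => (P n).real {ω | RIPW.date ξ (Y n) ∈
      RIPW.waldInterval p (P n) (W n) (Y n) a (τhat n ω) ω}) atTop := by
  have hT0 : T ≠ 0 := by omega
  have hM0 : 0 ≤ M := (abs_nonneg _).trans (hM 1 0 ⟨0, by omega⟩ true).le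
  have hY : ∀ n i t b, |Y n i t b| ≤ M := fun n i t b => (hM n i t b).le
  have hπ : ∀ n i, ∀ w ∈ S, c < RIPW.propensity (P n) (W n i) w := fun n =>
    (hoverlap n).lt_propensity
  have hDpos := RIPW.limitDD_pos hT0 hp (hoverlap 0).nontrivial (hoverlap 0).exists_nonconstant
  set z := RIPW.normalQuantile (1 - a / 2) with hz
  have hcov : 1 - a ≤ (gaussianReal 0 1).real (Set.Ioo (-z) z) := by
    have h1 := RIPW.le_cdf_normalQuantile (η := 1 - a / 2) (by linarith [ha.1])
    have h2 := RIPW.two_mul_cdf_sub_one_le z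
    rw [← hz] at h1
    linarith
  -- For negative `z` the interval would be empty, yet its mass is at least `1 - a > 0`.
  have hz0 : 0 ≤ z := by
    by_contra hcon
    rw [Set.Ioo_eq_empty (by linarith), measureReal_empty] at hcov
    linarith [ha.2]
  obtain ⟨B, hB⟩ := RIPW.exists_abs_influenceAt_le T (RIPW.radius T c M)
  have hV := RIPW.abs_pathInfluence_le hp hc hM0 hπ hY hξ_nonneg hξ_sum hB
  have hB0 : 0 ≤ B := (abs_nonneg _).trans (hV 1 0 fun _ => true)
  set v : ℕ → ℝ := fun n =>
    (n : ℝ)⁻¹ * ∑ i, variance (RIPW.V p ξ (P n) (W n) (Y n) i) (P n) with hv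
  -- The exponent must lie strictly between `1/4` and `1/2`: Chebyshev needs `n * κ² → ∞`, the
  -- quadratic remainder needs `√n * κ² → 0`.
  set κ : ℕ → ℝ := fun n => (n : ℝ) ^ (-(1 / 3) : ℝ) with hκ
  have hdev := RIPW.highProb_deviationsLT hW hindep hp hc hM0 hπ hY hξ_nonneg hξ_sum
    (κ := κ) (fun n hn => Real.rpow_pos_of_pos (Nat.cast_pos.2 hn) _)
    RIPW.tendsto_natCast_mul_rpow_sq
  have hκ0 : Tendsto κ atTop (𝓝 0) := RIPW.tendsto_rpow_neg_third
  have hmeas : ∀ n i, Measurable (RIPW.V p ξ (P n) (W n) (Y n) i) := fun n i =>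
    (measurable_of_finite (RIPW.pathInfluence p (P n) (W n) (Y n) ξ i)).comp (hW n i)
  have hint : ∀ n i, Integrable (RIPW.V p ξ (P n) (W n) (Y n) i) (P n) := fun n i =>
    RIPW.integrable_comp_path (hW n i) (RIPW.pathInfluence p (P n) (W n) (Y n) ξ i)
  have hmean : ∀ n i, |∫ ω, RIPW.V p ξ (P n) (W n) (Y n) i ω ∂(P n)| ≤ B := fun n i => by
    simpa using norm_integral_le_of_norm_le_const (μ := P n) (C := B)
      (f := RIPW.V p ξ (P n) (W n) (Y n) i) (.of_forall fun ω => hV n i _)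
  have hclt : ∀ b r : ℝ, 0 ≤ r → r < (gaussianReal 0 1).real (Set.Ioo (-b) b) →
      ∀ᶠ n : ℕ in atTop, r < (P n).real {ω | |∑ i, (RIPW.V p ξ (P n) (W n) (Y n) i ω -
        ∫ ω', RIPW.V p ξ (P n) (W n) (Y n) i ω' ∂(P n))| < b * (√n * √(v n))} := by
    intro b r hr0 hr
    refine RIPW.eventually_lt_measureReal_abs_sum_lt
      (X := fun n i ω => RIPW.V p ξ (P n) (W n) (Y n) i ω -
        ∫ ω', RIPW.V p ξ (P n) (W n) (Y n) i ω' ∂(P n)) (fun n i => (hmeas n i).sub_const _)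
      (fun n => ?_) (B := 2 * B) (fun n i ω => ?_) (fun n i => ?_) (fun n => ?_) hν₀ hvar hr0 hr
    · exact (hindep n).comp (fun i w => RIPW.pathInfluence p (P n) (W n) (Y n) ξ i w -
        ∫ ω', RIPW.V p ξ (P n) (W n) (Y n) i ω' ∂(P n)) fun i => measurable_of_finite _
    · have h1 : |RIPW.V p ξ (P n) (W n) (Y n) i ω| ≤ B := hV n i _
      exact (abs_sub _ _).trans (by linarith [hmean n i])
    · rw [integral_sub (hint n i) (integrable_const _)]
      simp
    · simp only [variance_eq_integral (hmeas n _).aemeasurable]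
  refine le_of_forall_lt_imp_le_of_dense fun q hq => ?_
  refine le_liminf_of_le (isCoboundedUnder_ge_of_le atTop fun n => measureReal_le_one) ?_
  -- The level passed to the central limit theorem must be nonnegative, hence `max q 0`.
  obtain ⟨r, hqr, hr1⟩ := exists_between (max_lt hq (sub_pos.2 ha.2))
  have hr0 : 0 ≤ r := (le_max_right q 0).trans hqr.le
  obtain ⟨b, hbz, hrb⟩ := RIPW.exists_lt_of_lt_measureReal_Ioo _ (hr1.trans_le hcov)
  refine hdev.eventually_le_measureReal ((le_max_left q 0).trans_lt hqr) (hclt b r hr0 hrb) ?_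
  obtain ⟨ε, hε, hεv⟩ := RIPW.exists_mul_add_le_mul_sqrt hν₀ hbz hz0
  -- This tolerance makes `8 * B * ε₁ ≤ ε / 2`, leaving the other half for `κ + κ ^ 2`; `B + 1`
  -- avoids division by zero.
  obtain ⟨δ, hδ, hinfl⟩ := RIPW.exists_abs_influenceAt_sub_le T (RIPW.radius T c M)
    (ε := ε / (16 * (B + 1))) (by positivity)
  obtain ⟨δ', hδ', hhalf⟩ := RIPW.exists_half_lt_sub_dotProduct (d := RIPW.limitDD p) rfl hDpos
  have hlim1 : Tendsto (fun n => (κ n + (1 + 2 * M) * (1 + T) * κ n ^ 2) / (RIPW.limitDD p / 2))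
      atTop (𝓝 0) := by
    simpa using (hκ0.add ((hκ0.pow 2).const_mul ((1 + 2 * M) * (1 + T)))).div_const
      (RIPW.limitDD p / 2)
  have hlim2 : Tendsto (fun n => κ n + κ n ^ 2) atTop (𝓝 0) := by
    simpa using hκ0.add (hκ0.pow 2)
  have hlim3 : Tendsto (fun n : ℕ => √(n : ℝ) * ((1 + 2 * M) * (1 + T) * κ n ^ 2)) atTop (𝓝 0) := by
    have h := RIPW.tendsto_sqrt_mul_rpow_sq.const_mul ((1 + 2 * M) * (1 + (T : ℝ)))
    rw [mul_zero] at h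
    refine h.congr fun n => ?_
    ring
  filter_upwards [hvar, eventually_gt_atTop 1, hκ0.eventually_le_const hδ,
    hκ0.eventually_le_const hδ', hlim1.eventually_lt_const hδ,
    hlim2.eventually_le_const (half_pos hε), hlim3.eventually_le_const hε]
    with n hvn hn hκδ hκδ' hτδ hκε hnε ω hdevω hcltω
  refine RIPW.date_mem_waldInterval_of_deviationsLT hT0 hn (hW n) hp hc hM0 (hπ n) (hY n) hξ_nonneg
    hξ_sum hDATE (hτhat n ω) hdevω (fun gθ gww gw h1 h2 h3 => hhalf gθ gww gw (h1.trans_le hκδ')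
      (h2.trans_le hκδ') fun t => (h3 t).trans_le hκδ') hDpos hB hinfl hκδ hτδ rfl
    (fun s hs => hεv _ _ hvn hs) ?_ hnε hcltω
  have h16 : 8 * B * (ε / (16 * (B + 1))) ≤ ε / 2 := by
    have hB1 : 0 < B + 1 := by linarith
    rw [mul_div_assoc', div_le_div_iff₀ (by positivity) two_pos]
    nlinarith
  linarith
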